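/- Let $m,n$ be fixed, let $\mathbf r\in\mathbb R^m_{>0}$, $\mathbf c\in\mathbb R^n_{>0}$ with $\|\mathbf r\|_1=\|\mathbf c\|_1=N$, and assume that $(\mathbf r,\mathbf c)$ is $\delta$-smooth for some $\delta>0$: $\delta N/m\le \mathbf r(i)\le N/(\delta m)$ and $\delta N/n\le \mathbf c(j)\le N/(\delta n)$ for all $i,j$. Let $\mathbf X\in\mathbb R^{m\times n}_{\ge 0}$ be a random matrix with independent entries and entrywise positive mean $\boldsymbol\Lambda=\mathbb E\mathbf X$, such that for some $\sigma,R>0$ and all integers $q\ge 2$, $\mathbb E|\mathbf X_{ij}-\boldsymbol\Lambda_{ij}|^q\le \frac{q!}{2}\sigma^2R^{q-2}$ for all $i,j$, and such that for some $K\ge 0$, $\bigl|\log\frac{\mathbf r(i)\mathbf c(j)\|\boldsymbol\Lambda\|_1}{\boldsymbol\Lambda_{ij}N^2}\bigr|\le K$ for all $i,j$, where $\|\boldsymbol\Lambda\|_1=\sum_{i,j}|\boldsymbol\Lambda_{ij}|$. Let $\boldsymbol\Sigma=\mathrm{Cov}(\mathrm{vec}(\mathbf X))$ and let $\bar{\mathbf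 X}_M$ be the empirical mean of $M$ i.i.d. copies of $\mathbf X$. Scaling potentials of a matrix $\mathbf A$ are pairs $(\boldsymbol\alpha,\boldsymbol\beta)\in\mathbb R^m\times\mathbb R^n$ such that $\mathbf D(e^{\boldsymbol\alpha})\mathbf A\mathbf D(e^{\boldsymbol\beta})$ has row sums $\mathbf r$ and column sums $\mathbf c$, where $\mathbf D(\cdot)$ is the diagonal matrix. They are considered under either of two normalizations: (a) $\sum_i\boldsymbol\alpha(i)=\sum_j\boldsymbol\beta(j)$, i.e. $(\boldsymbol\alpha,\boldsymbol\beta)$ is orthogonal to the direction $(\mathbf 1_m,-\mathbf 1_n)$; or (b) $\langle\boldsymbol\beta,\mathbf c\rangle=0$. Then, under each normalization, $\boldsymbol\Lambda$ has unique normalized scaling potentials $(\boldsymbol\alpha,\boldsymbol\beta)$, and with probability tending to $1$ as $M\to\infty$ so does $\bar{\mathbf X}_M$; denote those by $(\hat{\boldsymbol\alpha}_M,\hat{\boldsymbol\beta}_M)$ (set to $0$ where they do not exist or are not unique). Put $\boldsymbol\Lambda^{\mathbf r,\mathbf c}=\mathbf D(e^{\boldsymbol\alpha})\boldsymbol\Lambda\mathbf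 D(e^{\boldsymbol\beta})$ and $$\mathbf L=\begin{pmatrix}\mathbf D(\mathbf r)&\boldsymbol\Lambda^{\mathbf r,\mathbf c}\\(\boldsymbol\Lambda^{\mathbf r,\mathbf c})^\top&\mathbf D(\mathbf c)\end{pmatrix},\qquad \mathbf H\,\mathrm{vec}(\Delta)=\begin{pmatrix}\mathbf D(e^{\boldsymbol\alpha})\Delta\mathbf D(e^{\boldsymbol\beta})\mathbf 1_n\\(\mathbf D(e^{\boldsymbol\alpha})\Delta\mathbf D(e^{\boldsymbol\beta}))^\top\mathbf 1_m\end{pmatrix}$$ (any scaling potentials of $\boldsymbol\Lambda$ may be used here), and let $\mathbf L^\dagger$ be the Moore--Penrose pseudoinverse of $\mathbf L$. As $M\to\infty$, under normalization (a), $$\sqrt M\begin{pmatrix}\hat{\boldsymbol\alpha}_M-\boldsymbol\alpha\\\hat{\boldsymbol\beta}_M-\boldsymbol\beta\end{pmatrix}\xrightarrow{d}\mathcal N\bigl(0,\ \mathbf L^\dagger\mathbf H\boldsymbol\Sigma\mathbf H^\top(\mathbf L^\dagger)^\top\bigr),$$ and under normalization (b), $$\sqrt M\begin{pmatrix}\hat{\boldsymbol\alpha}_M-\boldsymbol\alpha\\\hat{\boldsymbol\beta}_M-\boldsymbol\beta\end{pmatrix}\xrightarrow{d}\mathcal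 N\bigl(0,\ \mathbf P_{\mathbf c}\mathbf L^\dagger\mathbf H\boldsymbol\Sigma\mathbf H^\top(\mathbf L^\dagger)^\top\mathbf P_{\mathbf c}^\top\bigr),$$ where $\mathbf P_{\mathbf c}(a,b)=(a+t\mathbf 1_m,\ b-t\mathbf 1_n)$ with $t=\langle b,\mathbf c\rangle/N$ is the projection along $(\mathbf 1_m,-\mathbf 1_n)$ onto $\{(a,b):\langle b,\mathbf c\rangle=0\}$. -/

import Mathlib

open MeasureTheory ProbabilityTheory Filter Topology

noncomputable section

namespace SinkhornCLT

/-! ### The Moore-Penrose pseudoinverse of a real matrix -/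

section Pseudoinverse

variable {p q : Type*} [Fintype p] [Fintype q]

/-- The four Penrose equations: `B` is the Moore-Penrose pseudoinverse of `A`. -/
structure IsMoorePenrose (A : Matrix p q ℝ) (B : Matrix q p ℝ) : Prop where
  mul_mul_left : A * B * A = A
  mul_mul_right : B * A * B = B
  symm_left : (A * B).transpose = A * B
  symm_right : (B * A).transpose = B * A

theorem IsMoorePenrose.unique {A : Matrix p q ℝ} {B C : Matrix q p ℝ}
    (hB : IsMoorePenrose A B) (hC : IsMoorePenrose A C) : B = C := by
  have h1 : A * B = A * C := by
    calc A * B = (A * C * A) * B := by rw [hC.mul_mul_left]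
      _ = (A * C) * (A * B) := by simp only [Matrix.mul_assoc]
      _ = (A * C).transpose * (A * B).transpose := by rw [hC.symm_left, hB.symm_left]
      _ = ((A * B) * (A * C)).transpose := by rw [← Matrix.transpose_mul]
      _ = ((A * B * A) * C).transpose := by simp only [Matrix.mul_assoc]
      _ = A * C := by rw [hB.mul_mul_left, hC.symm_left]
  have h2 : B * A = C * A := by
    calc B * A = B * (A * C * A) := by rw [hC.mul_mul_left]
      _ = (B * A) * (C * A) := by simp only [Matrix.mul_assoc]
      _ = (B * A).transpose * (C * A).transpose := by rw [hC.symm_right, hB.symm_right]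
      _ = ((C * A) * (B * A)).transpose := by rw [← Matrix.transpose_mul]
      _ = (C * (A * B * A)).transpose := by simp only [Matrix.mul_assoc]
      _ = C * A := by rw [hB.mul_mul_left, hC.symm_right]
  calc B = B * A * B := hB.mul_mul_right.symm
    _ = C * A * B := by rw [h2]
    _ = C * (A * B) := by rw [Matrix.mul_assoc]
    _ = C * (A * C) := by rw [h1]
    _ = C * A * C := by rw [Matrix.mul_assoc]
    _ = C := hC.mul_mul_right

theorem exists_isMoorePenrose_of_isHermitian {S : Matrix q q ℝ} (hS : S.IsHermitian) :
    ∃ T : Matrix q q ℝ, IsMoorePenrose S T ∧ T.transpose = T := by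
  classical
  set U : Matrix q q ℝ := hS.eigenvectorUnitary.1 with hU
  set d := hS.eigenvalues with hd
  have hUU : U.transpose * U = 1 := by
    have := Unitary.coe_star_mul_self hS.eigenvectorUnitary
    simpa [Matrix.star_eq_conjTranspose, Matrix.conjTranspose_eq_transpose_of_trivial] using this
  have hsp : S = U * Matrix.diagonal d * U.transpose := by
    have h := hS.spectral_theorem
    rw [Unitary.conjStarAlgAut_apply] at h
    simpa [Matrix.star_eq_conjTranspose, Matrix.conjTranspose_eq_transpose_of_trivial,
      Function.comp_def] using h
  have key : ∀ a b : q → ℝ, (U * Matrix.diagonal a * U.transpose) *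
      (U * Matrix.diagonal b * U.transpose) =
        U * Matrix.diagonal (fun k => a k * b k) * U.transpose := by
    intro a b
    calc _ = U * Matrix.diagonal a * (U.transpose * U) * Matrix.diagonal b * U.transpose := by
          simp only [Matrix.mul_assoc]
      _ = _ := by
          rw [hUU, Matrix.mul_one, Matrix.mul_assoc U, Matrix.diagonal_mul_diagonal]
  have ht : ∀ a : q → ℝ, (U * Matrix.diagonal a * U.transpose).transpose =
      U * Matrix.diagonal a * U.transpose := by
    intro a
    simp [Matrix.transpose_mul, Matrix.mul_assoc]
  refine ⟨U * Matrix.diagonal (fun k => (d k)⁻¹) * U.transpose, ⟨?_, ?_, ?_, ?_⟩, ht _⟩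
  · rw [hsp, key, key]
    congr 3
    funext k
    simp
  · rw [hsp, key, key]
    congr 3
    funext k
    by_cases h : d k = 0 <;> simp [h]
  · rw [hsp, key, ht]
  · rw [hsp, key, ht]

theorem exists_isMoorePenrose (A : Matrix p q ℝ) : ∃ B, IsMoorePenrose A B := by
  have hS : (A.transpose * A).IsHermitian := by
    rw [← Matrix.conjTranspose_eq_transpose_of_trivial]
    exact Matrix.isHermitian_conjTranspose_mul_self A
  classical
  obtain ⟨T, hT, hTs⟩ := exists_isMoorePenrose_of_isHermitian hS
  have hA : A * (T * (A.transpose * A)) = A := by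
    have h0 : A * (T * (A.transpose * A) - 1) = 0 := by
      rw [← Matrix.conjTranspose_mul_self_eq_zero,
        Matrix.conjTranspose_eq_transpose_of_trivial, Matrix.transpose_mul]
      have h : A.transpose * (A * (T * (A.transpose * A) - 1)) = 0 := by
        rw [← Matrix.mul_assoc, Matrix.mul_sub, Matrix.mul_one, ← Matrix.mul_assoc,
          hT.mul_mul_left, sub_self]
      rw [Matrix.mul_assoc, h, Matrix.mul_zero]
    rw [Matrix.mul_sub, Matrix.mul_one, sub_eq_zero] at h0
    exact h0
  refine ⟨T * A.transpose, ⟨?_, ?_, ?_, ?_⟩⟩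
  · simpa only [Matrix.mul_assoc] using hA
  · have := hT.mul_mul_right
    calc T * A.transpose * A * (T * A.transpose)
        = (T * (A.transpose * A) * T) * A.transpose := by simp only [Matrix.mul_assoc]
      _ = T * A.transpose := by rw [this]
  · simp only [Matrix.transpose_mul, Matrix.transpose_transpose, hTs, Matrix.mul_assoc]
  · rw [Matrix.mul_assoc]
    exact hT.symm_right

/-- The Moore-Penrose pseudoinverse `A†`. -/
def pinv (A : Matrix p q ℝ) : Matrix q p ℝ := (exists_isMoorePenrose A).choose

theorem isMoorePenrose_pinv (A : Matrix p q ℝ) : IsMoorePenrose A (pinv A) :=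
  (exists_isMoorePenrose A).choose_spec

end Pseudoinverse

/-! ### Margins, scaling potentials and their normalizations -/

variable {m n : ℕ}

/-- `(r, c)` is a strictly positive `m × n` margin: `‖r‖₁ = ‖c‖₁`. -/
structure IsPositiveMargin (r : Fin m → ℝ) (c : Fin n → ℝ) : Prop where
  row_pos : ∀ i, 0 < r i
  col_pos : ∀ j, 0 < c j
  sum_eq : ∑ i, r i = ∑ j, c j

/-- `δ`-smoothness of a margin with total mass `N = ∑ i, r i`. -/
structure IsSmoothMargin (δ : ℝ) (r : Fin m → ℝ) (c : Fin n → ℝ) : Prop where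
  delta_pos : 0 < δ
  row_lower : ∀ i, δ * (∑ k, r k) / m ≤ r i
  row_upper : ∀ i, r i ≤ (∑ k, r k) / (δ * m)
  col_lower : ∀ j, δ * (∑ k, r k) / n ≤ c j
  col_upper : ∀ j, c j ≤ (∑ k, r k) / (δ * n)

/-- Bounded cost of `Λ` with respect to `(r, c)`, with constant `K`. -/
def HasBoundedCost (K : ℝ) (r : Fin m → ℝ) (c : Fin n → ℝ) (Λ : Matrix (Fin m) (Fin n) ℝ) :
    Prop :=
  0 ≤ K ∧ ∀ i j,
    |Real.log (r i * c j * (∑ k, ∑ l, |Λ k l|) / (Λ i j * (∑ k, r k) ^ 2))| ≤ K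

/-- The space `ℝ^m × ℝ^n = ℝ^(m+n)` of potentials `ξ = (α, β)`, where `α i = ξ (Sum.inl i)` and
`β j = ξ (Sum.inr j)`. -/
abbrev Pot (m n : ℕ) : Type := EuclideanSpace ℝ (Fin m ⊕ Fin n)

/-- `D(e^α) A D(e^β)`. -/
def scaled (A : Matrix (Fin m) (Fin n) ℝ) (ξ : Pot m n) : Matrix (Fin m) (Fin n) ℝ :=
  Matrix.diagonal (fun i => Real.exp (ξ (Sum.inl i))) * A *
    Matrix.diagonal (fun j => Real.exp (ξ (Sum.inr j)))

/-- `ξ = (α, β)` are scaling potentials of `A` for the margin `(r, c)`. -/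
def IsScalingPotential (r : Fin m → ℝ) (c : Fin n → ℝ) (A : Matrix (Fin m) (Fin n) ℝ)
    (ξ : Pot m n) : Prop :=
  (∀ i, ∑ j, scaled A ξ i j = r i) ∧ ∀ j, ∑ i, scaled A ξ i j = c j

/-- The normalization `⟨β, c⟩ = 0`. -/
def ColCentered (c : Fin n → ℝ) (ξ : Pot m n) : Prop := ∑ j, ξ (Sum.inr j) * c j = 0

/-- The normalization `(α, β) ⟂ (1, -1)`, that is `∑ α i = ∑ β j`. -/
def GaugeOrthogonal (ξ : Pot m n) : Prop := ∑ i, ξ (Sum.inl i) = ∑ j, ξ (Sum.inr j)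

open scoped Classical in
/-- The scaling potentials of `A` for the margin `(r, c)` that satisfy the normalization `G`.
Where they do not exist or are not unique, the value is `0` by convention. -/
def potential (G : Pot m n → Prop) (r : Fin m → ℝ) (c : Fin n → ℝ)
    (A : Matrix (Fin m) (Fin n) ℝ) : Pot m n :=
  if h : ∃! ξ : Pot m n, IsScalingPotential r c A ξ ∧ G ξ then h.choose else 0

/-! ### The matrices in the limiting covariance -/

/-- `L = [[D(r), B], [Bᵀ, D(c)]]`. -/
def blockL (r : Fin m → ℝ) (c : Fin n → ℝ) (B : Matrix (Fin m) (Fin n) ℝ) :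
    Matrix (Fin m ⊕ Fin n) (Fin m ⊕ Fin n) ℝ :=
  Matrix.fromBlocks (Matrix.diagonal r) B B.transpose (Matrix.diagonal c)

/-- The matrix `H` of the linear map that sends `vec Δ` to the row and column sums of
`D(e^α) Δ D(e^β)`; see `opH_mulVec_vec`. -/
def opH (ξ : Pot m n) : Matrix (Fin m ⊕ Fin n) (Fin n × Fin m) ℝ :=
  Matrix.of fun k p =>
    Sum.elim (fun i => if p.2 = i then 1 else 0) (fun j => if p.1 = j then 1 else 0) k *
      Real.exp (ξ (Sum.inl p.2) + ξ (Sum.inr p.1))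

theorem scaled_apply (A : Matrix (Fin m) (Fin n) ℝ) (ξ : Pot m n) (i : Fin m) (j : Fin n) :
    scaled A ξ i j = Real.exp (ξ (Sum.inl i)) * A i j * Real.exp (ξ (Sum.inr j)) := by
  simp [scaled]

theorem opH_mulVec_vec (ξ : Pot m n) (D : Matrix (Fin m) (Fin n) ℝ) :
    (opH ξ).mulVec D.vec =
      Sum.elim ((scaled D ξ).mulVec 1) ((scaled D ξ).transpose.mulVec 1) := by
  funext k
  rcases k with i | j
  · simp only [Matrix.mulVec, dotProduct, opH, Matrix.of_apply, Sum.elim_inl, Matrix.vec,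
      Fintype.sum_prod_type, scaled_apply, Pi.one_apply, mul_one, Real.exp_add]
    refine Finset.sum_congr rfl fun j _ => ?_
    rw [Finset.sum_eq_single i]
    · simp; ring
    · intro b _ hb; simp [hb]
    · simp
  · simp only [Matrix.mulVec, dotProduct, opH, Matrix.of_apply, Sum.elim_inr, Matrix.vec,
      Fintype.sum_prod_type, scaled_apply, Pi.one_apply, mul_one, Real.exp_add,
      Matrix.transpose_apply]
    rw [Finset.sum_eq_single j]
    · refine Finset.sum_congr rfl fun i _ => ?_
      simp; ring
    · intro b _ hb; simp [hb]
    · simp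

/-- The projection `P_c` along the direction `(1, -1)` onto `{(a, b) : ⟨b, c⟩ = 0}`, that is
`P_c (a, b) = (a + t, b - t)` with `t = ⟨b, c⟩ / ∑ j, c j`. -/
def colProj (m : ℕ) (c : Fin n → ℝ) : Matrix (Fin m ⊕ Fin n) (Fin m ⊕ Fin n) ℝ :=
  1 + (∑ j, c j)⁻¹ •
    Matrix.vecMulVec (Sum.elim (fun _ => 1) (fun _ => -1)) (Sum.elim (fun _ => 0) c)

/-! ### Random matrices -/

/-- `Cov(vec X)`. -/
def covVec {Ω : Type*} [MeasurableSpace Ω] (P : Measure Ω)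
    (X : Ω → Matrix (Fin m) (Fin n) ℝ) : Matrix (Fin n × Fin m) (Fin n × Fin m) ℝ :=
  Matrix.of fun p q => covariance (fun ω => (X ω).vec p) (fun ω => (X ω).vec q) P

/-- `X` has independent nonnegative entries, entrywise positive mean `Λ`, and
`𝔼|X i j - Λ i j|^q ≤ (q!/2) σ² R^(q-2)` for all `q ≥ 2`. The moments are taken in `[0, ∞]`, so that
the bound includes their finiteness. -/
structure IsSubexponential {Ω : Type*} [MeasurableSpace Ω] (P : Measure Ω)
    (X : Ω → Matrix (Fin m) (Fin n) ℝ) (Λ : Matrix (Fin m) (Fin n) ℝ) (σ R : ℝ) : Prop where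
  aemeasurable : ∀ i j, AEMeasurable (fun ω => X ω i j) P
  indep : iIndepFun (fun (p : Fin m × Fin n) ω => X ω p.1 p.2) P
  nonneg : ∀ i j, ∀ᵐ ω ∂P, 0 ≤ X ω i j
  mean_pos : ∀ i j, 0 < Λ i j
  integrable : ∀ i j, Integrable (fun ω => X ω i j) P
  mean_eq : ∀ i j, ∫ ω, X ω i j ∂P = Λ i j
  sigma_pos : 0 < σ
  R_pos : 0 < R
  moment_le : ∀ q : ℕ, 2 ≤ q → ∀ i j,
    ∫⁻ ω, ENNReal.ofReal (|X ω i j - Λ i j| ^ q) ∂P ≤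
      ENNReal.ofReal ((q.factorial : ℝ) / 2 * σ ^ 2 * R ^ (q - 2))

/-- The empirical mean of the first `M` matrices of a sequence. -/
def empMean {Ω : Type*} (Y : ℕ → Ω → Matrix (Fin m) (Fin n) ℝ) (M : ℕ) (ω : Ω) :
    Matrix (Fin m) (Fin n) ℝ :=
  (M : ℝ)⁻¹ • ∑ l ∈ Finset.range M, Y l ω

end SinkhornCLT

end

open SinkhornCLT

namespace SinkhornCLT

/-! ### Existence and uniqueness of the scaling potentials of a positive matrix -/

section Potentials

variable {m n : ℕ} {r : Fin m → ℝ} {c : Fin n → ℝ} {A : Matrix (Fin m) (Fin n) ℝ}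

/-! The potentials are a differentiable function of the matrix near `Λ`, so the theorem is the delta
method applied to the central limit theorem for `√M (X̄_M - Λ)`. Existence comes from minimizing a
convex dual functional, and uniqueness up to the direction `g = (1, -1)` from the strict
monotonicity of `exp`. Differentiating the margin equations gives `H vec Δ + L d = 0`. Here `L` is
symmetric with kernel spanned by `g`, while `H vec Δ` is orthogonal to `g`, since row and column
sums have the same total. Adding `⟨g, ξ⟩ g` to the equations encodes normalization (a) and makes the
linearization `L + g gᵀ` invertible. The implicit function theorem then gives the derivative `-L† H`
(`hasFDerivAt_potential`), whose sign cancels in the covariance. The delta method also needs a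
potential that is measurable on the whole matrix space, including where the default value `0` is
taken. This holds because the solution set is closed and projections of closed sets in σ-compact
spaces are Borel (`measurable_potential`). For every matrix the potential in normalization (b) is
the image under `P_c` of the one in (a) (`potential_colCentered`), so the second limit is a linear
image of the first. -/

theorem scaled_apply' (A : Matrix (Fin m) (Fin n) ℝ) (ξ : Pot m n) (i : Fin m) (j : Fin n) :
    scaled A ξ i j = A i j * Real.exp (ξ (Sum.inl i) + ξ (Sum.inr j)) := by
  rw [scaled_apply, Real.exp_add]; ring

/-- The direction `(1, -1)` along which scaling potentials can be shifted. -/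
noncomputable def gaugeDir (m n : ℕ) : Pot m n :=
  WithLp.toLp 2 (Sum.elim (fun _ => 1) (fun _ => -1))

@[simp] theorem gaugeDir_inl (i : Fin m) : gaugeDir m n (Sum.inl i) = 1 := rfl

@[simp] theorem gaugeDir_inr (j : Fin n) : gaugeDir m n (Sum.inr j) = -1 := rfl

theorem scaled_add_smul_gaugeDir (A : Matrix (Fin m) (Fin n) ℝ) (ξ : Pot m n) (t : ℝ) :
    scaled A (ξ + t • gaugeDir m n) = scaled A ξ := by
  ext i j
  simp only [scaled_apply', PiLp.add_apply, PiLp.smul_apply, gaugeDir_inl, gaugeDir_inr,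
    smul_eq_mul]
  congr 2; ring

theorem IsScalingPotential.add_smul_gaugeDir {ξ : Pot m n} (h : IsScalingPotential r c A ξ)
    (t : ℝ) : IsScalingPotential r c A (ξ + t • gaugeDir m n) := by
  simpa only [IsScalingPotential, scaled_add_smul_gaugeDir] using h

theorem opH_add_smul_gaugeDir (ξ : Pot m n) (t : ℝ) :
    opH (ξ + t • gaugeDir m n) = opH ξ := by
  ext k p
  simp only [opH, Matrix.of_apply, PiLp.add_apply, PiLp.smul_apply, gaugeDir_inl, gaugeDir_inr,
    smul_eq_mul]
  congr 2; ring

/-- An empty side has mass zero and a nonempty one has positive mass. Hence the degenerate cases `m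
= 0` and `n = 0` occur only together, and then all spaces are trivial. -/
theorem IsPositiveMargin.nonempty_iff (hrc : IsPositiveMargin r c) :
    Nonempty (Fin m) ↔ Nonempty (Fin n) := by
  constructor
  · intro h
    by_contra hn
    rw [not_nonempty_iff] at hn
    have := hrc.sum_eq
    rw [Finset.univ_eq_empty (α := Fin n), Finset.sum_empty] at this
    exact (Finset.sum_pos (fun i _ => hrc.row_pos i) Finset.univ_nonempty).ne' this
  · intro h
    by_contra hn
    rw [not_nonempty_iff] at hn
    have := hrc.sum_eq
    rw [Finset.univ_eq_empty (α := Fin m), Finset.sum_empty] at this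
    exact (Finset.sum_pos (fun i _ => hrc.col_pos i) Finset.univ_nonempty).ne this

/-- A vector all of whose sums `a i + b j` vanish is a multiple of `(1, -1)`. -/
theorem IsPositiveMargin.exists_eq_smul_gaugeDir (hrc : IsPositiveMargin r c) {x : Pot m n}
    (hx : ∀ i j, x (Sum.inl i) + x (Sum.inr j) = 0) : ∃ t : ℝ, x = t • gaugeDir m n := by
  by_cases h : Nonempty (Fin m)
  · obtain ⟨j⟩ := hrc.nonempty_iff.1 h
    obtain ⟨i⟩ := h
    refine ⟨x (Sum.inl i), ?_⟩
    ext k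
    rcases k with k | k
    · have h1 := hx i j
      have h2 := hx k j
      simp; linarith
    · have h1 := hx i k
      simp; linarith
  · have hn := mt hrc.nonempty_iff.2 h
    rw [not_nonempty_iff] at h hn
    exact ⟨0, Subsingleton.elim _ _⟩

theorem sum_mul_add_eq (B : Matrix (Fin m) (Fin n) ℝ) (x : Pot m n) :
    ∑ i, ∑ j, B i j * (x (Sum.inl i) + x (Sum.inr j)) =
      ∑ i, (∑ j, B i j) * x (Sum.inl i) + ∑ j, (∑ i, B i j) * x (Sum.inr j) := by
  simp only [mul_add, Finset.sum_add_distrib, Finset.sum_mul]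
  congr 1
  exact Finset.sum_comm

/-- Two scaling potentials of a positive matrix differ by a multiple of `(1, -1)`. -/
theorem IsScalingPotential.exists_eq_add (hrc : IsPositiveMargin r c) (hA : ∀ i j, 0 < A i j)
    {ξ ξ' : Pot m n} (h : IsScalingPotential r c A ξ) (h' : IsScalingPotential r c A ξ') :
    ∃ t : ℝ, ξ' = ξ + t • gaugeDir m n := by
  -- The two scaled matrices have equal margins, so their difference is orthogonal to every array of
  -- the form `a i + b j`. Strict monotonicity of `exp` makes each term nonnegative, so each
  -- vanishes.
  have hz : ∑ i, ∑ j, (scaled A ξ' i j - scaled A ξ i j) *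
      ((ξ' - ξ) (Sum.inl i) + (ξ' - ξ) (Sum.inr j)) = 0 := by
    have := sum_mul_add_eq (scaled A ξ' - scaled A ξ) (ξ' - ξ)
    simp only [Matrix.sub_apply] at this
    rw [this]
    simp [Finset.sum_sub_distrib, h.1, h.2, h'.1, h'.2]
  have key : ∀ u v : ℝ, u ≠ v → 0 < (Real.exp u - Real.exp v) * (u - v) := by
    intro u v huv
    rcases lt_or_gt_of_ne huv with hlt | hlt
    · exact mul_pos_of_neg_of_neg (sub_neg.2 (Real.exp_lt_exp.2 hlt)) (sub_neg.2 hlt)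
    · exact mul_pos (sub_pos.2 (Real.exp_lt_exp.2 hlt)) (sub_pos.2 hlt)
  have hterm : ∀ i j, (scaled A ξ' i j - scaled A ξ i j) *
      ((ξ' - ξ) (Sum.inl i) + (ξ' - ξ) (Sum.inr j)) =
      A i j * ((Real.exp (ξ' (Sum.inl i) + ξ' (Sum.inr j)) -
        Real.exp (ξ (Sum.inl i) + ξ (Sum.inr j))) *
          ((ξ' (Sum.inl i) + ξ' (Sum.inr j)) - (ξ (Sum.inl i) + ξ (Sum.inr j)))) := by
    intro i j
    simp only [scaled_apply', PiLp.sub_apply]; ring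
  have hnn : ∀ i j, 0 ≤ (scaled A ξ' i j - scaled A ξ i j) *
      ((ξ' - ξ) (Sum.inl i) + (ξ' - ξ) (Sum.inr j)) := by
    intro i j
    rw [hterm]
    by_cases hs : ξ' (Sum.inl i) + ξ' (Sum.inr j) = ξ (Sum.inl i) + ξ (Sum.inr j)
    · simp [hs]
    · exact (mul_pos (hA i j) (key _ _ hs)).le
  obtain ⟨t, ht⟩ := hrc.exists_eq_smul_gaugeDir (x := ξ' - ξ) (by
    intro i j
    have h1 := (Finset.sum_eq_zero_iff_of_nonneg
      (fun i _ => Finset.sum_nonneg fun j _ => hnn i j)).1 hz i (Finset.mem_univ _)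
    have h2 := (Finset.sum_eq_zero_iff_of_nonneg (fun j _ => hnn i j)).1 h1 j (Finset.mem_univ _)
    by_contra hne
    rw [hterm] at h2
    refine (mul_pos (hA i j) (key _ _ fun hs => hne ?_)).ne' h2
    simp only [PiLp.sub_apply]; linarith)
  exact ⟨t, by rw [← ht]; abel⟩

/-! ### Existence by minimization of the dual functional -/

/-- Coercivity of one summand of the dual functional. For `s > 0` use `exp s ≥ s² / 2`; the constant
`2 w² / a` completes the square `(a s - 2 w)² / (2 a)`. -/
theorem mul_abs_le_mul_exp_sub {a w : ℝ} (ha : 0 < a) (hw : 0 < w) (s : ℝ) :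
    w * |s| ≤ a * Real.exp s - w * s + 2 * w ^ 2 / a := by
  have hpos : 0 < 2 * w ^ 2 / a := by positivity
  rcases le_or_gt s 0 with hs | hs
  · rw [abs_of_nonpos hs]
    have := mul_pos ha (Real.exp_pos s)
    linarith
  · rw [abs_of_pos hs]
    have h1 : a * (s ^ 2 / 2) ≤ a * Real.exp s := by
      have := Real.quadratic_le_exp_of_nonneg hs.le
      exact mul_le_mul_of_nonneg_left (by linarith) ha.le
    have h2 : a * (s ^ 2 / 2) - 2 * w * s + 2 * w ^ 2 / a = (a * s - 2 * w) ^ 2 / (2 * a) := by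
      field_simp; ring
    have h3 : 0 ≤ (a * s - 2 * w) ^ 2 / (2 * a) := by positivity
    linarith

/-- The convex function whose minimizers are the scaling potentials, written with weights
`w i j = r i * c j / N`. -/
noncomputable def dualFun (A w : Matrix (Fin m) (Fin n) ℝ) (x : Pot m n) : ℝ :=
  ∑ i, ∑ j, (A i j * Real.exp (x (Sum.inl i) + x (Sum.inr j)) -
    w i j * (x (Sum.inl i) + x (Sum.inr j)))

theorem dualFun_add_smul_gaugeDir (A w : Matrix (Fin m) (Fin n) ℝ) (x : Pot m n) (t : ℝ) :
    dualFun A w (x + t • gaugeDir m n) = dualFun A w x := by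
  have : ∀ i j, x (Sum.inl i) + t * 1 + (x (Sum.inr j) + t * -1) =
      x (Sum.inl i) + x (Sum.inr j) := fun i j => by ring
  simp only [dualFun, PiLp.add_apply, PiLp.smul_apply, gaugeDir_inl, gaugeDir_inr, smul_eq_mul,
    this]

/-- On a sublevel set coercivity bounds only the sums `x i + y j`. Invariance under `(1, -1)` allows
one row coordinate to be set to zero, which bounds all coordinates and leaves a compact problem. -/
theorem exists_dualFun_le [Nonempty (Fin m)] [Nonempty (Fin n)] {w : Matrix (Fin m) (Fin n) ℝ}
    (hA : ∀ i j, 0 < A i j) (hw : ∀ i j, 0 < w i j) :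
    ∃ x : Pot m n, ∀ y, dualFun A w x ≤ dualFun A w y := by
  obtain ⟨i₀⟩ := ‹Nonempty (Fin m)›
  obtain ⟨j₀⟩ := ‹Nonempty (Fin n)›
  set C : ℝ := dualFun A w 0 + ∑ i, ∑ j, 2 * w i j ^ 2 / A i j with hC
  have hle : ∀ x : Pot m n, dualFun A w x ≤ dualFun A w 0 → ∀ i j,
      |x (Sum.inl i) + x (Sum.inr j)| ≤ C / w i j := by
    intro x hx i j
    rw [le_div_iff₀' (hw i j)]
    calc w i j * |x (Sum.inl i) + x (Sum.inr j)|
        ≤ ∑ i, ∑ j, w i j * |x (Sum.inl i) + x (Sum.inr j)| := by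
          have hnn : ∀ i j, 0 ≤ w i j * |x (Sum.inl i) + x (Sum.inr j)| := fun i j =>
            mul_nonneg (hw i j).le (abs_nonneg _)
          exact (Finset.single_le_sum (fun j _ => hnn i j) (Finset.mem_univ j)).trans
            (Finset.single_le_sum (f := fun i => ∑ j, w i j * |x (Sum.inl i) + x (Sum.inr j)|)
              (fun i _ => Finset.sum_nonneg fun j _ => hnn i j) (Finset.mem_univ i))
      _ ≤ ∑ i, ∑ j, (A i j * Real.exp (x (Sum.inl i) + x (Sum.inr j)) -
            w i j * (x (Sum.inl i) + x (Sum.inr j)) + 2 * w i j ^ 2 / A i j) :=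
          Finset.sum_le_sum fun i _ => Finset.sum_le_sum fun j _ =>
            mul_abs_le_mul_exp_sub (hA i j) (hw i j) _
      _ = dualFun A w x + ∑ i, ∑ j, 2 * w i j ^ 2 / A i j := by
          simp only [Finset.sum_add_distrib, dualFun]
      _ ≤ C := by rw [hC]; linarith
  set R : ℝ := ∑ i, ∑ j, C / w i j with hR
  have hCnn : ∀ i j, 0 ≤ C / w i j := fun i j => (abs_nonneg _).trans (hle 0 le_rfl i j)
  have hleR : ∀ i j, C / w i j ≤ R := fun i j =>
    (Finset.single_le_sum (fun j _ => hCnn i j) (Finset.mem_univ j)).trans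
      (Finset.single_le_sum (f := fun i => ∑ j, C / w i j)
        (fun i _ => Finset.sum_nonneg fun j _ => hCnn i j) (Finset.mem_univ i))
  have hRnn : 0 ≤ R := (hCnn i₀ j₀).trans (hleR i₀ j₀)
  -- Once the row coordinate at `i₀` vanishes, column coordinates are at most `R` in absolute value,
  -- and row coordinates then at most `2 * R`.
  set S : Set (Pot m n) := {x | ∀ k, |x k| ≤ 2 * R} with hS
  have hScl : IsClosed S := by
    rw [hS]
    simp only [Set.ofPred_forall]
    exact isClosed_iInter fun k => isClosed_le (by fun_prop) continuous_const
  have hSb : Bornology.IsBounded S := by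
    rw [isBounded_iff_forall_norm_le]
    refine ⟨√(∑ _k : Fin m ⊕ Fin n, (2 * R) ^ 2), fun x hx => ?_⟩
    rw [EuclideanSpace.norm_eq]
    refine Real.sqrt_le_sqrt (Finset.sum_le_sum fun k _ => ?_)
    rw [Real.norm_eq_abs]
    exact pow_le_pow_left₀ (abs_nonneg _) (hx k) 2
  have h0 : (0 : Pot m n) ∈ S := fun k => by simpa using hRnn
  have hcont : Continuous (dualFun A w) := by
    unfold dualFun; fun_prop
  obtain ⟨x, -, hx⟩ := (Metric.isCompact_of_isClosed_isBounded hScl hSb).exists_isMinOn ⟨0, h0⟩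
    hcont.continuousOn
  refine ⟨x, fun y => ?_⟩
  rcases le_or_gt (dualFun A w y) (dualFun A w 0) with hy | hy
  · set z := y + (-y (Sum.inl i₀)) • gaugeDir m n with hz
    rw [← dualFun_add_smul_gaugeDir A w y (-y (Sum.inl i₀)), ← hz]
    have hz0 : z (Sum.inl i₀) = 0 := by simp [hz]
    have hb := hle z (by rw [hz, dualFun_add_smul_gaugeDir]; exact hy)
    have hcol : ∀ j, |z (Sum.inr j)| ≤ R := fun j => by
      have := (hb i₀ j).trans (hleR i₀ j)
      rwa [hz0, zero_add] at this
    refine hx fun k => ?_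
    rcases k with i | j
    · have h1 := abs_le.1 ((hb i j₀).trans (hleR i j₀))
      have h2 := abs_le.1 (hcol j₀)
      rw [abs_le]
      constructor <;> linarith [h1.1, h1.2, h2.1, h2.2]
    · exact (hcol j).trans (by linarith)
  · exact (hx h0).trans hy.le

/-- First-order condition at a minimizer, obtained by differentiating along the line `x + t • d`. -/
theorem sum_eq_zero_of_dualFun_le {w : Matrix (Fin m) (Fin n) ℝ} {x : Pot m n}
    (hx : ∀ y, dualFun A w x ≤ dualFun A w y) (d : Pot m n) :
    ∑ i, ∑ j, (scaled A x i j - w i j) * (d (Sum.inl i) + d (Sum.inr j)) = 0 := by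
  have hd : HasDerivAt (fun t : ℝ => dualFun A w (x + t • d))
      (∑ i, ∑ j, (scaled A x i j - w i j) * (d (Sum.inl i) + d (Sum.inr j))) 0 := by
    unfold dualFun
    refine HasDerivAt.fun_sum fun i _ => HasDerivAt.fun_sum fun j _ => ?_
    have hlin : HasDerivAt (fun t : ℝ => (x + t • d) (Sum.inl i) + (x + t • d) (Sum.inr j))
        (d (Sum.inl i) + d (Sum.inr j)) 0 := by
      have := ((hasDerivAt_id (0 : ℝ)).mul_const (d (Sum.inl i) + d (Sum.inr j))).const_add
        (x (Sum.inl i) + x (Sum.inr j))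
      convert! this using 1
      · funext t; simp; ring
      · simp
    convert! (hlin.exp.const_mul (A i j)).sub (hlin.const_mul (w i j)) using 1
    simp [scaled_apply']; ring
  refine IsLocalMin.hasDerivAt_eq_zero (Filter.Eventually.of_forall fun t => ?_) hd
  simpa using hx (x + t • d)

theorem exists_isScalingPotential (hrc : IsPositiveMargin r c) (hA : ∀ i j, 0 < A i j) :
    ∃ ξ, IsScalingPotential r c A ξ := by
  by_cases hm : Nonempty (Fin m)
  · have hn := hrc.nonempty_iff.1 hm
    set N := ∑ i, r i with hN
    have hNpos : 0 < N := Finset.sum_pos (fun i _ => hrc.row_pos i) Finset.univ_nonempty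
    -- The independent coupling: positive weights, as coercivity requires, with margins `r` and `c`.
    -- Stationarity in the coordinate directions therefore says that the scaled matrix has these
    -- margins.
    set w : Matrix (Fin m) (Fin n) ℝ := Matrix.of fun i j => r i * c j / N with hw
    obtain ⟨x, hx⟩ := exists_dualFun_le (w := w) hA fun i j =>
      div_pos (mul_pos (hrc.row_pos i) (hrc.col_pos j)) hNpos
    refine ⟨x, ?_⟩
    have h := sum_eq_zero_of_dualFun_le hx
    have hrow : ∀ i, ∑ j, w i j = r i := fun i => by
      simp only [hw, Matrix.of_apply]
      rw [← Finset.sum_div, ← Finset.mul_sum, ← hrc.sum_eq, ← hN]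
      field_simp
    have hcol : ∀ j, ∑ i, w i j = c j := fun j => by
      simp only [hw, Matrix.of_apply]
      rw [← Finset.sum_div, ← Finset.sum_mul, ← hN]
      field_simp
    have h' : ∀ d : Pot m n, _ := fun d => (sum_mul_add_eq (scaled A x - w) d).symm.trans (h d)
    simp only [Matrix.sub_apply, Finset.sum_sub_distrib, hrow, hcol] at h'
    constructor
    · intro i
      have := h' (EuclideanSpace.single (Sum.inl i) 1)
      simp at this
      linarith
    · intro j
      have := h' (EuclideanSpace.single (Sum.inr j) 1)
      simp at this
      linarith
  · have hn := mt hrc.nonempty_iff.2 hm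
    rw [not_nonempty_iff] at hm hn
    exact ⟨0, fun i => hm.elim i, fun j => hn.elim j⟩

/-- A linear normalization that is transversal to `(1, -1)` selects exactly one of the scaling
potentials of a positive matrix. -/
theorem existsUnique_of_normalization (hrc : IsPositiveMargin r c) (hA : ∀ i j, 0 < A i j)
    {G : Pot m n → Prop} (hex : ∀ ξ, ∃ t : ℝ, G (ξ + t • gaugeDir m n))
    (huniq : ∀ ξ, ∀ t : ℝ, G ξ → G (ξ + t • gaugeDir m n) → t • gaugeDir m n = 0) :
    ∃! ξ, IsScalingPotential r c A ξ ∧ G ξ := by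
  obtain ⟨ξ, hξ⟩ := exists_isScalingPotential hrc hA
  obtain ⟨t, ht⟩ := hex ξ
  refine ⟨_, ⟨hξ.add_smul_gaugeDir t, ht⟩, ?_⟩
  rintro η ⟨hη, hη'⟩
  obtain ⟨s, rfl⟩ := (hξ.add_smul_gaugeDir t).exists_eq_add hrc hA hη
  rw [huniq _ s ht hη', add_zero]

/-- The linear functional `⟨(1, -1), ξ⟩` that defines the normalization `GaugeOrthogonal`. -/
theorem gaugeOrthogonal_iff {ξ : Pot m n} :
    GaugeOrthogonal ξ ↔ ∑ i, ξ (Sum.inl i) - ∑ j, ξ (Sum.inr j) = 0 := sub_eq_zero.symm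

theorem gaugeOrthogonal_add_smul_iff {ξ : Pot m n} {t : ℝ} :
    GaugeOrthogonal (ξ + t • gaugeDir m n) ↔
      ∑ i, ξ (Sum.inl i) - ∑ j, ξ (Sum.inr j) + t * (m + n) = 0 := by
  rw [gaugeOrthogonal_iff]
  simp only [PiLp.add_apply, PiLp.smul_apply, gaugeDir_inl, gaugeDir_inr, smul_eq_mul,
    Finset.sum_add_distrib, Finset.sum_const, Finset.card_univ, Fintype.card_fin, nsmul_eq_mul]
  constructor <;> intro h <;> linarith

theorem colCentered_add_smul_iff {ξ : Pot m n} {t : ℝ} :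
    ColCentered c (ξ + t • gaugeDir m n) ↔ ∑ j, ξ (Sum.inr j) * c j - t * ∑ j, c j = 0 := by
  unfold ColCentered
  simp only [PiLp.add_apply, PiLp.smul_apply, gaugeDir_inr, smul_eq_mul, add_mul,
    Finset.sum_add_distrib, mul_neg, mul_one, neg_mul, Finset.sum_neg_distrib, Finset.mul_sum]
  rw [sub_eq_add_neg]

theorem IsPositiveMargin.sum_col_pos (hrc : IsPositiveMargin r c) (hm : Nonempty (Fin m)) :
    0 < ∑ j, c j :=
  have := hrc.nonempty_iff.1 hm
  Finset.sum_pos (fun j _ => hrc.col_pos j) Finset.univ_nonempty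

theorem exists_gaugeOrthogonal_add (ξ : Pot m n) :
    ∃ t : ℝ, GaugeOrthogonal (ξ + t • gaugeDir m n) := by
  rcases Nat.eq_zero_or_pos (m + n) with h | h
  · obtain ⟨rfl, rfl⟩ := Nat.add_eq_zero_iff.1 h
    exact ⟨0, by simp [GaugeOrthogonal]⟩
  · refine ⟨-(∑ i, ξ (Sum.inl i) - ∑ j, ξ (Sum.inr j)) / (m + n), ?_⟩
    have : (0 : ℝ) < m + n := by exact_mod_cast h
    rw [gaugeOrthogonal_add_smul_iff]
    field_simp; ring

theorem smul_gaugeDir_eq_zero_of_gaugeOrthogonal {ξ : Pot m n} {t : ℝ} (h : GaugeOrthogonal ξ)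
    (h' : GaugeOrthogonal (ξ + t • gaugeDir m n)) : t • gaugeDir m n = 0 := by
  rw [gaugeOrthogonal_add_smul_iff, gaugeOrthogonal_iff.1 h, zero_add] at h'
  rcases mul_eq_zero.1 h' with h0 | h0
  · rw [h0, zero_smul]
  · have h0 : m + n = 0 := by exact_mod_cast h0
    obtain ⟨rfl, rfl⟩ := Nat.add_eq_zero_iff.1 h0
    exact Subsingleton.elim _ _

theorem existsUnique_gaugeOrthogonal (hrc : IsPositiveMargin r c) (hA : ∀ i j, 0 < A i j) :
    ∃! ξ, IsScalingPotential r c A ξ ∧ GaugeOrthogonal ξ :=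
  existsUnique_of_normalization hrc hA exists_gaugeOrthogonal_add
    fun _ _ => smul_gaugeDir_eq_zero_of_gaugeOrthogonal

/-! ### Passing between the two normalizations -/

theorem colProj_mulVec (c : Fin n → ℝ) (ξ : Pot m n) :
    (colProj m c).mulVec ξ.ofLp =
      (ξ + ((∑ j, c j)⁻¹ * ∑ j, ξ (Sum.inr j) * c j) • gaugeDir m n).ofLp := by
  rw [colProj, Matrix.add_mulVec, Matrix.one_mulVec, Matrix.smul_mulVec, Matrix.vecMulVec_mulVec]
  funext k
  have : Sum.elim (fun _ => 0) c ⬝ᵥ ξ.ofLp = ∑ j, ξ (Sum.inr j) * c j := by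
    simp [dotProduct, mul_comm]
  rw [this]
  rcases k with i | j <;> simp

theorem colCentered_toLp_colProj (hrc : IsPositiveMargin r c) (ξ : Pot m n) :
    ColCentered c (WithLp.toLp 2 ((colProj m c).mulVec ξ.ofLp)) := by
  rw [colProj_mulVec, WithLp.toLp_ofLp, colCentered_add_smul_iff]
  by_cases hm : Nonempty (Fin m)
  · have := hrc.sum_col_pos hm
    field_simp; ring
  · have hn := mt hrc.nonempty_iff.2 hm
    rw [not_nonempty_iff] at hn
    simp

theorem smul_gaugeDir_eq_zero_of_colCentered (hrc : IsPositiveMargin r c) {ξ : Pot m n} {t : ℝ}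
    (h : ColCentered c ξ) (h' : ColCentered c (ξ + t • gaugeDir m n)) :
    t • gaugeDir m n = 0 := by
  rw [colCentered_add_smul_iff, h, zero_sub, neg_eq_zero] at h'
  by_cases hm : Nonempty (Fin m)
  · rw [(mul_eq_zero.1 h').resolve_right (hrc.sum_col_pos hm).ne', zero_smul]
  · have hn := mt hrc.nonempty_iff.2 hm
    rw [not_nonempty_iff] at hm hn
    exact Subsingleton.elim _ _

theorem IsScalingPotential.toLp_colProj {ξ : Pot m n} (h : IsScalingPotential r c A ξ) :
    IsScalingPotential r c A (WithLp.toLp 2 ((colProj m c).mulVec ξ.ofLp)) := by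
  rw [colProj_mulVec, WithLp.toLp_ofLp]
  exact h.add_smul_gaugeDir _

/-- `P_c` moves points only along `(1, -1)`, a direction transversal to the gauge-orthogonal
subspace, so it is injective there. -/
theorem eq_of_toLp_colProj_eq {ξ η : Pot m n} (hξ : GaugeOrthogonal ξ) (hη : GaugeOrthogonal η)
    (h : WithLp.toLp 2 ((colProj m c).mulVec ξ.ofLp) =
      WithLp.toLp 2 ((colProj m c).mulVec η.ofLp)) : ξ = η := by
  rw [colProj_mulVec, colProj_mulVec, WithLp.toLp_ofLp, WithLp.toLp_ofLp] at h
  set s := (∑ j, c j)⁻¹ * ∑ j, ξ (Sum.inr j) * c j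
  set t := (∑ j, c j)⁻¹ * ∑ j, η (Sum.inr j) * c j
  have h1 : η = ξ + (s - t) • gaugeDir m n := by
    rw [sub_smul, ← add_sub_assoc, h, add_sub_cancel_right]
  rw [h1] at hη
  rw [h1, smul_gaugeDir_eq_zero_of_gaugeOrthogonal hξ hη, add_zero]

theorem exists_toLp_colProj_eq (hrc : IsPositiveMargin r c) {η : Pot m n}
    (h : IsScalingPotential r c A η) (hη : ColCentered c η) :
    ∃ ξ, IsScalingPotential r c A ξ ∧ GaugeOrthogonal ξ ∧
      WithLp.toLp 2 ((colProj m c).mulVec ξ.ofLp) = η := by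
  obtain ⟨t, ht⟩ := exists_gaugeOrthogonal_add η
  refine ⟨_, h.add_smul_gaugeDir t, ht, ?_⟩
  have h1 := colCentered_toLp_colProj hrc (η + t • gaugeDir m n)
  rw [colProj_mulVec, WithLp.toLp_ofLp, add_assoc, ← add_smul] at h1 ⊢
  rw [smul_gaugeDir_eq_zero_of_colCentered hrc hη h1, add_zero]

/-- `P_c` maps the gauge-orthogonal scaling potentials bijectively onto the column-centered ones. No
positivity of `A` is needed, so both potentials take the default value for the same matrices. -/
theorem existsUnique_colCentered_iff (hrc : IsPositiveMargin r c) (A : Matrix (Fin m) (Fin n) ℝ) :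
    (∃! ξ, IsScalingPotential r c A ξ ∧ ColCentered c ξ) ↔
      ∃! ξ, IsScalingPotential r c A ξ ∧ GaugeOrthogonal ξ := by
  constructor
  · rintro ⟨η, ⟨hη, hηc⟩, hu⟩
    obtain ⟨ξ, hξ, hξg, -⟩ := exists_toLp_colProj_eq hrc hη hηc
    refine ⟨ξ, ⟨hξ, hξg⟩, fun ζ hζ => eq_of_toLp_colProj_eq (c := c) hζ.2 hξg ?_⟩
    rw [hu _ ⟨hζ.1.toLp_colProj, colCentered_toLp_colProj hrc ζ⟩,
      hu _ ⟨hξ.toLp_colProj, colCentered_toLp_colProj hrc ξ⟩]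
  · rintro ⟨ξ, ⟨hξ, -⟩, hu⟩
    refine ⟨_, ⟨hξ.toLp_colProj, colCentered_toLp_colProj hrc ξ⟩, ?_⟩
    rintro η ⟨hη, hηc⟩
    obtain ⟨ζ, hζ, hζg, rfl⟩ := exists_toLp_colProj_eq hrc hη hηc
    rw [hu ζ ⟨hζ, hζg⟩]

theorem potential_eq {G : Pot m n → Prop} {ξ : Pot m n}
    (h : ∃! ξ, IsScalingPotential r c A ξ ∧ G ξ) (hξ : IsScalingPotential r c A ξ) (hG : G ξ) :
    potential G r c A = ξ := by
  rw [potential, dif_pos h]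
  exact h.unique h.choose_spec.1 ⟨hξ, hG⟩

theorem potential_spec {G : Pot m n → Prop} (h : ∃! ξ, IsScalingPotential r c A ξ ∧ G ξ) :
    IsScalingPotential r c A (potential G r c A) ∧ G (potential G r c A) := by
  rw [potential, dif_pos h]
  exact h.choose_spec.1

/-- The two normalized potentials are related by `colProj`. -/
theorem potential_colCentered (hrc : IsPositiveMargin r c) (A : Matrix (Fin m) (Fin n) ℝ) :
    potential (ColCentered c) r c A =
      WithLp.toLp 2 ((colProj m c).mulVec (potential GaugeOrthogonal r c A).ofLp) := by
  by_cases h : ∃! ξ, IsScalingPotential r c A ξ ∧ GaugeOrthogonal ξ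
  · exact potential_eq ((existsUnique_colCentered_iff hrc A).2 h)
      (potential_spec h).1.toLp_colProj (colCentered_toLp_colProj hrc _)
  -- Both potentials are the default `0` here, which the linear map `P_c` fixes.
  · rw [potential, potential, dif_neg h, dif_neg (mt (existsUnique_colCentered_iff hrc A).1 h)]
    simp

end Potentials

/-! ### Differentiability of the potentials -/

section Derivative

variable {m n : ℕ} {r : Fin m → ℝ} {c : Fin n → ℝ} {A : Matrix (Fin m) (Fin n) ℝ}

/-! ### The kernel of `L` and its pseudoinverse -/

theorem gaugeDir_dotProduct (x : Fin m ⊕ Fin n → ℝ) :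
    (gaugeDir m n).ofLp ⬝ᵥ x = ∑ i, x (Sum.inl i) - ∑ j, x (Sum.inr j) := by
  simp [dotProduct, sub_eq_add_neg]

theorem blockL_transpose (B : Matrix (Fin m) (Fin n) ℝ) :
    (blockL r c B).transpose = blockL r c B := by
  simp [blockL, Matrix.fromBlocks_transpose]

theorem blockL_mulVec_inl (B : Matrix (Fin m) (Fin n) ℝ) (x : Fin m ⊕ Fin n → ℝ) (i : Fin m) :
    (blockL r c B).mulVec x (Sum.inl i) =
      r i * x (Sum.inl i) + ∑ j, B i j * x (Sum.inr j) := by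
  rw [blockL, Matrix.fromBlocks_mulVec]
  simp [Matrix.mulVec_diagonal]
  simp [Matrix.mulVec, dotProduct]

theorem blockL_mulVec_inr (B : Matrix (Fin m) (Fin n) ℝ) (x : Fin m ⊕ Fin n → ℝ) (j : Fin n) :
    (blockL r c B).mulVec x (Sum.inr j) =
      ∑ i, B i j * x (Sum.inl i) + c j * x (Sum.inr j) := by
  rw [blockL, Matrix.fromBlocks_mulVec]
  simp [Matrix.mulVec_diagonal]
  simp [Matrix.mulVec, dotProduct]

/-- `L` is the signless Laplacian of the complete bipartite graph with edge weights `B`; the sum of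
squares shows its kernel. -/
theorem dotProduct_blockL_mulVec {B : Matrix (Fin m) (Fin n) ℝ} (hr : ∀ i, ∑ j, B i j = r i)
    (hc : ∀ j, ∑ i, B i j = c j) (x : Fin m ⊕ Fin n → ℝ) :
    x ⬝ᵥ (blockL r c B).mulVec x =
      ∑ i, ∑ j, B i j * (x (Sum.inl i) + x (Sum.inr j)) ^ 2 := by
  have h1 : ∀ i j, B i j * (x (Sum.inl i) + x (Sum.inr j)) ^ 2 =
      B i j * (x (Sum.inl i) ^ 2) + x (Sum.inl i) * (B i j * x (Sum.inr j)) +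
      (x (Sum.inr j) * (B i j * x (Sum.inl i)) + B i j * x (Sum.inr j) ^ 2) :=
    fun i j => by ring
  simp only [h1, Finset.sum_add_distrib]
  rw [Finset.sum_comm (f := fun i j => x (Sum.inr j) * (B i j * x (Sum.inl i))),
    Finset.sum_comm (f := fun i j => B i j * x (Sum.inr j) ^ 2)]
  simp only [← Finset.sum_mul, ← Finset.mul_sum, hr, hc, dotProduct, Fintype.sum_sum_type,
    blockL_mulVec_inl, blockL_mulVec_inr, mul_add, Finset.sum_add_distrib]
  congr 2
  · exact Finset.sum_congr rfl fun i _ => by ring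
  · exact Finset.sum_congr rfl fun i _ => by ring

theorem blockL_mulVec_gaugeDir {B : Matrix (Fin m) (Fin n) ℝ} (hr : ∀ i, ∑ j, B i j = r i)
    (hc : ∀ j, ∑ i, B i j = c j) : (blockL r c B).mulVec (gaugeDir m n).ofLp = 0 := by
  funext k
  rcases k with i | j
  · simp [blockL_mulVec_inl, hr]
  · simp [blockL_mulVec_inr, hc]

theorem exists_eq_smul_of_blockL_mulVec_eq_zero (hrc : IsPositiveMargin r c)
    {B : Matrix (Fin m) (Fin n) ℝ} (hB : ∀ i j, 0 < B i j) (hr : ∀ i, ∑ j, B i j = r i)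
    (hc : ∀ j, ∑ i, B i j = c j) {x : Fin m ⊕ Fin n → ℝ} (hx : (blockL r c B).mulVec x = 0) :
    ∃ t : ℝ, x = t • (gaugeDir m n).ofLp := by
  have h := dotProduct_blockL_mulVec hr hc x
  rw [hx, dotProduct_zero] at h
  have hnn : ∀ i j, 0 ≤ B i j * (x (Sum.inl i) + x (Sum.inr j)) ^ 2 := fun i j =>
    mul_nonneg (hB i j).le (sq_nonneg _)
  obtain ⟨t, ht⟩ := hrc.exists_eq_smul_gaugeDir (x := WithLp.toLp 2 x) (by
    intro i j
    have h1 := (Finset.sum_eq_zero_iff_of_nonneg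
      (fun i _ => Finset.sum_nonneg fun j _ => hnn i j)).1 h.symm i (Finset.mem_univ _)
    have h2 := (Finset.sum_eq_zero_iff_of_nonneg (fun j _ => hnn i j)).1 h1 j (Finset.mem_univ _)
    exact pow_eq_zero_iff two_ne_zero |>.1 ((mul_eq_zero.1 h2).resolve_left (hB i j).ne'))
  exact ⟨t, congrArg WithLp.ofLp ht⟩

/-- The conclusion is not `t = 0`, because `(1, -1)` is the zero vector when `m = n = 0`. -/
theorem smul_gaugeDir_eq_zero {t : ℝ}
    (h : (gaugeDir m n).ofLp ⬝ᵥ (t • (gaugeDir m n).ofLp) = 0) :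
    t • (gaugeDir m n).ofLp = 0 := by
  have h1 : (t • (gaugeDir m n).ofLp) ⬝ᵥ (t • (gaugeDir m n).ofLp) = 0 := by
    rw [smul_dotProduct, h, smul_zero]
  exact dotProduct_self_eq_zero.1 h1

theorem gaugeDir_dotProduct_blockL_mulVec {B : Matrix (Fin m) (Fin n) ℝ}
    (hr : ∀ i, ∑ j, B i j = r i) (hc : ∀ j, ∑ i, B i j = c j) (x : Fin m ⊕ Fin n → ℝ) :
    (gaugeDir m n).ofLp ⬝ᵥ (blockL r c B).mulVec x = 0 := by
  rw [Matrix.dotProduct_mulVec, ← Matrix.mulVec_transpose, blockL_transpose,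
    blockL_mulVec_gaugeDir hr hc, zero_dotProduct]

/-- Since `L† = L† L L†` and `L† L` is symmetric, the range of `L†` is orthogonal to the kernel of
`L`. -/
theorem gaugeDir_dotProduct_pinv_mulVec {B : Matrix (Fin m) (Fin n) ℝ}
    (hr : ∀ i, ∑ j, B i j = r i) (hc : ∀ j, ∑ i, B i j = c j) (z : Fin m ⊕ Fin n → ℝ) :
    (gaugeDir m n).ofLp ⬝ᵥ (pinv (blockL r c B)).mulVec z = 0 := by
  have hP := isMoorePenrose_pinv (blockL r c B)
  rw [← hP.mul_mul_right, ← Matrix.mulVec_mulVec, Matrix.dotProduct_mulVec,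
    ← Matrix.mulVec_transpose, hP.symm_right, ← Matrix.mulVec_mulVec,
    blockL_mulVec_gaugeDir hr hc, Matrix.mulVec_zero, zero_dotProduct]

/-- `z - L L† z` lies in the kernel of `L`, because `L L L† = L` by transposing a Penrose equation.
It is also orthogonal to `(1, -1)`, which spans that kernel, so it is zero. -/
theorem blockL_mulVec_pinv_mulVec (hrc : IsPositiveMargin r c) {B : Matrix (Fin m) (Fin n) ℝ}
    (hB : ∀ i j, 0 < B i j) (hr : ∀ i, ∑ j, B i j = r i) (hc : ∀ j, ∑ i, B i j = c j)
    {z : Fin m ⊕ Fin n → ℝ} (hz : (gaugeDir m n).ofLp ⬝ᵥ z = 0) :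
    (blockL r c B).mulVec ((pinv (blockL r c B)).mulVec z) = z := by
  have hP := isMoorePenrose_pinv (blockL r c B)
  set L := blockL r c B with hL
  have hLt : L.transpose = L := blockL_transpose B
  have h0 : L.mulVec (z - L.mulVec ((pinv L).mulVec z)) = 0 := by
    have : L * (L * pinv L) = L := by
      have := congrArg Matrix.transpose hP.mul_mul_left
      rwa [Matrix.transpose_mul, hP.symm_left, hLt] at this
    rw [Matrix.mulVec_sub, Matrix.mulVec_mulVec, Matrix.mulVec_mulVec, Matrix.mul_assoc, this,
      sub_self]
  obtain ⟨t, ht⟩ := exists_eq_smul_of_blockL_mulVec_eq_zero hrc hB hr hc h0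
  have h1 : (gaugeDir m n).ofLp ⬝ᵥ (t • (gaugeDir m n).ofLp) = 0 := by
    rw [← ht, dotProduct_sub, hz, gaugeDir_dotProduct_blockL_mulVec hr hc, sub_self]
  rw [smul_gaugeDir_eq_zero h1] at ht
  exact (sub_eq_zero.1 ht).symm

/-- `x ↦ L x + ⟨(1, -1), x⟩ (1, -1)` is injective. -/
theorem eq_zero_of_blockL_mulVec_add_eq_zero (hrc : IsPositiveMargin r c)
    {B : Matrix (Fin m) (Fin n) ℝ} (hB : ∀ i j, 0 < B i j) (hr : ∀ i, ∑ j, B i j = r i)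
    (hc : ∀ j, ∑ i, B i j = c j) {x : Fin m ⊕ Fin n → ℝ}
    (hx : (blockL r c B).mulVec x + ((gaugeDir m n).ofLp ⬝ᵥ x) • (gaugeDir m n).ofLp = 0) :
    x = 0 := by
  have h1 : ((gaugeDir m n).ofLp ⬝ᵥ x) • (gaugeDir m n).ofLp = 0 := by
    refine smul_gaugeDir_eq_zero ?_
    have := congrArg ((gaugeDir m n).ofLp ⬝ᵥ ·) hx
    simpa only [dotProduct_add, gaugeDir_dotProduct_blockL_mulVec hr hc, zero_add,
      dotProduct_zero] using this
  rw [h1, add_zero] at hx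
  obtain ⟨t, rfl⟩ := exists_eq_smul_of_blockL_mulVec_eq_zero hrc hB hr hc hx
  refine smul_gaugeDir_eq_zero ?_
  have := congrArg ((t • (gaugeDir m n).ofLp) ⬝ᵥ ·) h1
  simp only [dotProduct_smul, smul_dotProduct, dotProduct_zero, smul_eq_mul] at this ⊢
  rcases mul_eq_zero.1 this with h | h
  · exact h
  · exact h

/-- The matrix with a given vectorization. -/
def unvec (x : EuclideanSpace ℝ (Fin n × Fin m)) : Matrix (Fin m) (Fin n) ℝ :=
  Matrix.of fun i j => x (j, i)

@[simp] theorem unvec_apply (x : EuclideanSpace ℝ (Fin n × Fin m)) (i : Fin m) (j : Fin n) :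
    unvec x i j = x (j, i) := rfl

@[simp] theorem vec_unvec (x : EuclideanSpace ℝ (Fin n × Fin m)) : (unvec x).vec = x.ofLp := rfl

/-! ### The margin equations and their linearization -/

theorem opH_mulVec_inl (ξ : Pot m n) (x : EuclideanSpace ℝ (Fin n × Fin m)) (i : Fin m) :
    (opH ξ).mulVec x.ofLp (Sum.inl i) = ∑ j, scaled (unvec x) ξ i j := by
  rw [← vec_unvec, opH_mulVec_vec]
  simp [Matrix.mulVec, dotProduct]

theorem opH_mulVec_inr (ξ : Pot m n) (x : EuclideanSpace ℝ (Fin n × Fin m)) (j : Fin n) :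
    (opH ξ).mulVec x.ofLp (Sum.inr j) = ∑ i, scaled (unvec x) ξ i j := by
  rw [← vec_unvec, opH_mulVec_vec]
  simp [Matrix.mulVec, dotProduct]

theorem isScalingPotential_iff {ξ : Pot m n} {x : EuclideanSpace ℝ (Fin n × Fin m)} :
    IsScalingPotential r c (unvec x) ξ ↔ (opH ξ).mulVec x.ofLp = Sum.elim r c := by
  rw [funext_iff, Sum.forall]
  simp only [opH_mulVec_inl, opH_mulVec_inr, Sum.elim_inl, Sum.elim_inr]
  rfl

theorem gaugeDir_dotProduct_opH_mulVec (ξ : Pot m n) (x : EuclideanSpace ℝ (Fin n × Fin m)) :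
    (gaugeDir m n).ofLp ⬝ᵥ (opH ξ).mulVec x.ofLp = 0 := by
  rw [gaugeDir_dotProduct]
  simp only [opH_mulVec_inl, opH_mulVec_inr]
  rw [Finset.sum_comm, sub_self]

theorem IsPositiveMargin.gaugeDir_dotProduct_elim (hrc : IsPositiveMargin r c) :
    (gaugeDir m n).ofLp ⬝ᵥ Sum.elim r c = 0 := by
  rw [gaugeDir_dotProduct]
  simp [hrc.sum_eq]

/-- The map whose zeros are the pairs of a matrix and its gauge-orthogonal scaling potential. -/
noncomputable def marginMap (r : Fin m → ℝ) (c : Fin n → ℝ)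
    (u : EuclideanSpace ℝ (Fin n × Fin m) × Pot m n) : Pot m n :=
  WithLp.toLp 2 ((opH u.2).mulVec u.1.ofLp - Sum.elim r c +
    ((gaugeDir m n).ofLp ⬝ᵥ u.2.ofLp) • (gaugeDir m n).ofLp)

/-- The margin defect is orthogonal to `(1, -1)` and the added term is parallel to it, so the two
vanish separately. -/
theorem marginMap_eq_zero_iff (hrc : IsPositiveMargin r c)
    {u : EuclideanSpace ℝ (Fin n × Fin m) × Pot m n} :
    marginMap r c u = 0 ↔ IsScalingPotential r c (unvec u.1) u.2 ∧ GaugeOrthogonal u.2 := by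
  rw [isScalingPotential_iff, gaugeOrthogonal_iff, ← gaugeDir_dotProduct u.2.ofLp]
  constructor
  · intro h
    have h0 : (opH u.2).mulVec u.1.ofLp - Sum.elim r c +
        ((gaugeDir m n).ofLp ⬝ᵥ u.2.ofLp) • (gaugeDir m n).ofLp = 0 := congrArg WithLp.ofLp h
    have h1 : ((gaugeDir m n).ofLp ⬝ᵥ u.2.ofLp) • (gaugeDir m n).ofLp = 0 := by
      refine smul_gaugeDir_eq_zero ?_
      have := congrArg ((gaugeDir m n).ofLp ⬝ᵥ ·) h0
      simpa only [dotProduct_add, dotProduct_sub, gaugeDir_dotProduct_opH_mulVec,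
        hrc.gaugeDir_dotProduct_elim, sub_self, zero_add, dotProduct_zero] using this
    rw [h1, add_zero] at h0
    refine ⟨sub_eq_zero.1 h0, ?_⟩
    have := congrArg (u.2.ofLp ⬝ᵥ ·) h1
    simpa [dotProduct_smul, dotProduct_comm u.2.ofLp] using this
  · rintro ⟨h1, h2⟩
    rw [marginMap, h1, h2]
    simp

theorem marginMap_inl (u : EuclideanSpace ℝ (Fin n × Fin m) × Pot m n) (i : Fin m) :
    marginMap r c u (Sum.inl i) =
      ∑ j, u.1 (j, i) * Real.exp (u.2 (Sum.inl i) + u.2 (Sum.inr j)) - r i +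
        (∑ i, u.2 (Sum.inl i) - ∑ j, u.2 (Sum.inr j)) := by
  simp [marginMap, opH_mulVec_inl, scaled_apply', gaugeDir_dotProduct]

theorem marginMap_inr (u : EuclideanSpace ℝ (Fin n × Fin m) × Pot m n) (j : Fin n) :
    marginMap r c u (Sum.inr j) =
      ∑ i, u.1 (j, i) * Real.exp (u.2 (Sum.inl i) + u.2 (Sum.inr j)) - c j -
        (∑ i, u.2 (Sum.inl i) - ∑ j, u.2 (Sum.inr j)) := by
  simp [marginMap, opH_mulVec_inr, scaled_apply', gaugeDir_dotProduct]
  ring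

theorem contDiff_marginMap : ContDiff ℝ 1 (marginMap (m := m) (n := n) r c) := by
  rw [contDiff_euclidean]
  rintro (i | j)
  · simp only [marginMap_inl]
    fun_prop
  · simp only [marginMap_inr]
    fun_prop

/-- For fixed `ξ` the map is affine in the matrix, so it equals its first-order expansion along a
line. -/
theorem fderiv_marginMap_fst (x y : EuclideanSpace ℝ (Fin n × Fin m)) (ξ : Pot m n) :
    fderiv ℝ (marginMap r c) (x, ξ) (y, 0) = WithLp.toLp 2 ((opH ξ).mulVec y.ofLp) := by
  have h1 := ((contDiff_marginMap (r := r) (c := c)).differentiable one_ne_zero (x, ξ)).hasFDerivAt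
  have hline : HasDerivAt (fun t : ℝ => ((x, ξ) : EuclideanSpace ℝ (Fin n × Fin m) × Pot m n) +
      t • (y, 0)) (y, 0) 0 := by
    simpa using ((hasDerivAt_id (0 : ℝ)).smul_const
      ((y, 0) : EuclideanSpace ℝ (Fin n × Fin m) × Pot m n)).const_add (x, ξ)
  have h2 := HasFDerivAt.comp_hasDerivAt (0 : ℝ)
    (f := fun t : ℝ => ((x, ξ) : EuclideanSpace ℝ (Fin n × Fin m) × Pot m n) + t • (y, 0))
    (by simpa using h1) hline
  refine h2.unique ?_
  have h3 : HasDerivAt (fun t : ℝ => marginMap r c (x, ξ) +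
      t • WithLp.toLp 2 ((opH ξ).mulVec y.ofLp)) (WithLp.toLp 2 ((opH ξ).mulVec y.ofLp)) 0 := by
    simpa using ((hasDerivAt_id (0 : ℝ)).smul_const
      (WithLp.toLp 2 ((opH ξ).mulVec y.ofLp) : Pot m n)).const_add (marginMap r c (x, ξ))
  convert! h3 using 1
  funext t
  ext k
  simp [marginMap, Matrix.mulVec_add, Matrix.mulVec_smul]
  ring

/-- Differentiating the exponentials puts the margins of the scaled matrix on the diagonal; these
are `r` and `c` precisely because `ξ` is a scaling potential. -/
theorem fderiv_marginMap_snd {x : EuclideanSpace ℝ (Fin n × Fin m)} {ξ : Pot m n}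
    (hξ : IsScalingPotential r c (unvec x) ξ) (d : Pot m n) :
    fderiv ℝ (marginMap r c) (x, ξ) (0, d) =
      WithLp.toLp 2 ((blockL r c (scaled (unvec x) ξ)).mulVec d.ofLp +
        ((gaugeDir m n).ofLp ⬝ᵥ d.ofLp) • (gaugeDir m n).ofLp) := by
  have h1 := ((contDiff_marginMap (r := r) (c := c)).differentiable one_ne_zero (x, ξ)).hasFDerivAt
  have hline : HasDerivAt (fun t : ℝ => ((x, ξ) : EuclideanSpace ℝ (Fin n × Fin m) × Pot m n) +
      t • (0, d)) (0, d) 0 := by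
    simpa using ((hasDerivAt_id (0 : ℝ)).smul_const
      ((0, d) : EuclideanSpace ℝ (Fin n × Fin m) × Pot m n)).const_add (x, ξ)
  have h2 := HasFDerivAt.comp_hasDerivAt (0 : ℝ)
    (f := fun t : ℝ => ((x, ξ) : EuclideanSpace ℝ (Fin n × Fin m) × Pot m n) + t • (0, d))
    (by simpa using h1) hline
  have hlin : ∀ k, HasDerivAt (fun t : ℝ => (ξ + t • d) k) (d k) 0 := by
    intro k
    have := ((hasDerivAt_id (0 : ℝ)).mul_const (d k)).const_add (ξ k)
    simpa using this
  have hexp : ∀ i j, HasDerivAt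
      (fun t : ℝ => x (j, i) * Real.exp ((ξ + t • d) (Sum.inl i) + (ξ + t • d) (Sum.inr j)))
      (scaled (unvec x) ξ i j * (d (Sum.inl i) + d (Sum.inr j))) 0 := by
    intro i j
    convert! (((hlin (Sum.inl i)).add (hlin (Sum.inr j))).exp.const_mul (x (j, i))) using 1
    simp [scaled_apply']; ring
  have hg : HasDerivAt
      (fun t : ℝ => ∑ i, (ξ + t • d) (Sum.inl i) - ∑ j, (ξ + t • d) (Sum.inr j))
      (∑ i, d (Sum.inl i) - ∑ j, d (Sum.inr j)) 0 :=
    (HasDerivAt.fun_sum fun i _ => hlin (Sum.inl i)).fun_sub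
      (HasDerivAt.fun_sum fun j _ => hlin (Sum.inr j))
  ext k
  refine ((EuclideanSpace.proj (𝕜 := ℝ) k).hasFDerivAt.comp_hasDerivAt (0 : ℝ) h2).unique ?_
  rcases k with i | j
  · have := ((HasDerivAt.fun_sum (u := Finset.univ) fun j _ => hexp i j).sub_const (r i)).add hg
    convert! this using 1
    · funext t
      simp [marginMap_inl]
    · simp only [Pi.add_apply, blockL_mulVec_inl, ← hξ.1 i, gaugeDir_dotProduct,
        Pi.smul_apply, gaugeDir_inl, smul_eq_mul, mul_one, mul_add, Finset.sum_add_distrib,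
        Finset.sum_mul]
  · have := ((HasDerivAt.fun_sum (u := Finset.univ) fun i _ => hexp i j).sub_const (c j)).sub hg
    convert! this using 1
    · funext t
      simp [marginMap_inr]
    · simp only [Pi.add_apply, blockL_mulVec_inr, ← hξ.2 j, gaugeDir_dotProduct,
        Pi.smul_apply, gaugeDir_inr, smul_eq_mul, mul_add, Finset.sum_add_distrib,
        Finset.sum_mul]
      ring

theorem scaled_pos (hA : ∀ i j, 0 < A i j) (ξ : Pot m n) (i : Fin m) (j : Fin n) :
    0 < scaled A ξ i j := by
  rw [scaled_apply']
  exact mul_pos (hA i j) (Real.exp_pos _)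

theorem isInvertible_of_injective {E : Type*} [NormedAddCommGroup E] [NormedSpace ℝ E]
    [FiniteDimensional ℝ E] {f : E →L[ℝ] E} (hf : ∀ x, f x = 0 → x = 0) : f.IsInvertible := by
  have hinj : Function.Injective f.toLinearMap :=
    (injective_iff_map_eq_zero f.toLinearMap).2 hf
  refine ⟨(LinearEquiv.ofInjectiveEndo f.toLinearMap hinj).toContinuousLinearEquiv, ?_⟩
  ext x
  rfl

/-- The gauge-orthogonal potential is differentiable at a positive matrix, with derivative
`-L† H`. -/
theorem hasFDerivAt_potential (hrc : IsPositiveMargin r c) (hA : ∀ i j, 0 < A i j) {ξ : Pot m n}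
    (hξ : IsScalingPotential r c A ξ) :
    HasFDerivAt (fun x : EuclideanSpace ℝ (Fin n × Fin m) =>
        potential GaugeOrthogonal r c (unvec x))
      (LinearMap.toContinuousLinearMap
        (Matrix.toLpLin 2 2 (-(pinv (blockL r c (scaled A ξ)) * opH ξ))))
      (WithLp.toLp 2 A.vec) := by
  set x₀ : EuclideanSpace ℝ (Fin n × Fin m) := WithLp.toLp 2 A.vec with hx₀
  obtain ⟨hη, hηg⟩ := potential_spec (existsUnique_gaugeOrthogonal hrc hA)
  set η := potential GaugeOrthogonal r c A with hη_def
  -- `L` and `H` do not change under shifts along `(1, -1)`, so `ξ` may be replaced by the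
  -- normalized potential `η`.
  obtain ⟨s, hs⟩ := hη.exists_eq_add hrc hA hξ
  rw [hs, scaled_add_smul_gaugeDir, opH_add_smul_gaugeDir]
  set B := scaled A η with hB_def
  have hB : ∀ i j, 0 < B i j := scaled_pos hA η
  have hd : HasStrictFDerivAt (marginMap r c) (fderiv ℝ (marginMap r c) (x₀, η)) (x₀, η) :=
    contDiff_marginMap.contDiffAt.hasStrictFDerivAt one_ne_zero
  have hinr : ∀ d : Pot m n, (fderiv ℝ (marginMap r c) (x₀, η) ∘L
      .inr ℝ (EuclideanSpace ℝ (Fin n × Fin m)) (Pot m n)) d =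
      WithLp.toLp 2 ((blockL r c B).mulVec d.ofLp +
        ((gaugeDir m n).ofLp ⬝ᵥ d.ofLp) • (gaugeDir m n).ofLp) := fun d =>
    fderiv_marginMap_snd (x := x₀) hη d
  have hinv : (fderiv ℝ (marginMap r c) (x₀, η) ∘L
      .inr ℝ (EuclideanSpace ℝ (Fin n × Fin m)) (Pot m n)).IsInvertible := by
    refine isInvertible_of_injective fun d hd => ?_
    rw [hinr] at hd
    have := eq_zero_of_blockL_mulVec_add_eq_zero hrc hB hη.1 hη.2 (congrArg WithLp.ofLp hd)
    exact congrArg (WithLp.toLp 2) this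
  have hψ := (hd.hasStrictFDerivAt_implicitFunctionOfProdDomain hinv).hasFDerivAt
  have hzero : marginMap r c (x₀, η) = 0 := (marginMap_eq_zero_iff hrc).2 ⟨hη, hηg⟩
  have hpos : ∀ᶠ x in 𝓝 x₀, ∀ i j, 0 < unvec x i j := by
    rw [eventually_all]
    intro i
    rw [eventually_all]
    intro j
    have : Continuous fun x : EuclideanSpace ℝ (Fin n × Fin m) => unvec x i j := by
      simp only [unvec_apply]; fun_prop
    exact this.continuousAt.eventually (lt_mem_nhds (hA i j))
  -- Near `x₀` the matrix is still positive, so the zero produced by the implicit function is its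
  -- unique normalized potential.
  have heq : (fun x : EuclideanSpace ℝ (Fin n × Fin m) =>
      potential GaugeOrthogonal r c (unvec x)) =ᶠ[𝓝 x₀] hd.implicitFunctionOfProdDomain hinv := by
    filter_upwards [hd.eventually_apply_implicitFunctionOfProdDomain hinv, hpos] with x hx hxp
    rw [hzero, marginMap_eq_zero_iff hrc] at hx
    exact potential_eq (existsUnique_gaugeOrthogonal hrc hxp) hx.1 hx.2
  refine (hψ.congr_of_eventuallyEq heq).congr_fderiv ?_
  ext1 y
  have hy : (fderiv ℝ (marginMap r c) (x₀, η) ∘L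
      .inl ℝ (EuclideanSpace ℝ (Fin n × Fin m)) (Pot m n)) y =
      WithLp.toLp 2 ((opH η).mulVec y.ofLp) := fderiv_marginMap_fst x₀ y η
  rw [neg_apply, ContinuousLinearMap.comp_apply, hy]
  obtain ⟨e, he⟩ := hinv
  have hz := gaugeDir_dotProduct_opH_mulVec η y
  -- The vector `d = L† H y` solves the full linearized system: `L d = H y` because `H y ⟂ (1, -1)`,
  -- and the added term vanishes because `d ⟂ (1, -1)`.
  have hsol := hinr (WithLp.toLp 2 ((pinv (blockL r c B)).mulVec ((opH η).mulVec y.ofLp)))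
  rw [blockL_mulVec_pinv_mulVec hrc hB hη.1 hη.2 hz,
    gaugeDir_dotProduct_pinv_mulVec hη.1 hη.2, zero_smul, add_zero] at hsol
  rw [← he, ContinuousLinearMap.inverse_equiv, ← hsol, ← he]
  simp only [ContinuousLinearEquiv.coe_coe, ContinuousLinearEquiv.symm_apply_apply]
  simp [Matrix.toLpLin_apply, Matrix.mulVec_mulVec]

end Derivative

/-! ### Measurability of the potentials -/

section Measurability

theorem _root_.IsSigmaCompact.measurableSet {E : Type*} [TopologicalSpace E] [T2Space E]
    [MeasurableSpace E] [BorelSpace E] {s : Set E} (hs : IsSigmaCompact s) : MeasurableSet s := by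
  obtain ⟨K, hK, rfl⟩ := hs
  exact MeasurableSet.iUnion fun k => (hK k).measurableSet

variable {E F : Type*} [TopologicalSpace E] [T2Space E] [SigmaCompactSpace E] [MeasurableSpace E]
  [BorelSpace E] [MetricSpace F] [SigmaCompactSpace F]

/-- A closed subset of a σ-compact space is σ-compact, and so is its continuous image; hence the
projection is Borel, not merely analytic. -/
theorem measurableSet_image_fst {X : Type*} [TopologicalSpace X] [SigmaCompactSpace X]
    {S : Set (E × X)} (hS : IsClosed S) : MeasurableSet (Prod.fst '' S) :=
  ((isSigmaCompact_univ.of_isClosed_subset hS (Set.subset_univ _)).image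
    continuous_fst).measurableSet

/-- Uniqueness fails exactly when two solutions are at distance at least `1 / (k + 1)` for some `k`.
For each `k` this is a closed condition on the triple, so its projection is Borel. -/
theorem measurableSet_existsUnique {S : Set (E × F)} (hS : IsClosed S) :
    MeasurableSet {x | ∃! y, (x, y) ∈ S} := by
  have h : {x | ∃! y, (x, y) ∈ S} = (Prod.fst '' S) \
      ⋃ k : ℕ, Prod.fst '' {u : E × F × F | (u.1, u.2.1) ∈ S ∧ (u.1, u.2.2) ∈ S ∧
        1 / ((k : ℝ) + 1) ≤ dist u.2.1 u.2.2} := by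
    ext x
    simp only [Set.mem_ofPred_eq, Set.mem_sdiff, Set.mem_image, Prod.exists, exists_and_right,
      exists_eq_right, Set.mem_iUnion, not_exists, not_and, not_le]
    constructor
    · rintro ⟨y, hy, hu⟩
      refine ⟨⟨y, hy⟩, fun k z z' hz hz' => ?_⟩
      rw [hu z hz, hu z' hz', dist_self]
      positivity
    · rintro ⟨⟨y, hy⟩, hu⟩
      refine ⟨y, hy, fun z hz => ?_⟩
      by_contra hne
      obtain ⟨k, hk⟩ := exists_nat_one_div_lt (dist_pos.2 hne)
      exact lt_asymm hk (hu k z y hz hy)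
  rw [h]
  refine (measurableSet_image_fst hS).diff (MeasurableSet.iUnion fun k =>
    measurableSet_image_fst ?_)
  exact (hS.preimage (f := fun u : E × F × F => (u.1, u.2.1)) (by fun_prop)).inter
    ((hS.preimage (f := fun u : E × F × F => (u.1, u.2.2)) (by fun_prop)).inter
      (isClosed_le (f := fun _ : E × F × F => 1 / ((k : ℝ) + 1))
        (g := fun u : E × F × F => dist u.2.1 u.2.2) continuous_const (by fun_prop)))

/-- A function whose graph is, over the points of unique existence, a closed set, and that is
constant elsewhere, is measurable. -/
theorem measurable_of_existsUnique_mem [MeasurableSpace F] [BorelSpace F] {S : Set (E × F)}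
    (hS : IsClosed S) {g : E → F} (hg : ∀ x, (∃! y, (x, y) ∈ S) → (x, g x) ∈ S) {y₀ : F}
    (hg' : ∀ x, (¬ ∃! y, (x, y) ∈ S) → g x = y₀) : Measurable g := by
  refine measurable_of_isClosed fun C hC => ?_
  have hU := measurableSet_existsUnique hS
  -- Where the solution is unique, `g x ∈ C` means that the fibre of `S` over `x` meets `C`, which
  -- is again a projection of a closed set.
  have h : g ⁻¹' C = ({x | ∃! y, (x, y) ∈ S} ∩ Prod.fst '' (S ∩ Prod.snd ⁻¹' C)) ∪
      ({x | ∃! y, (x, y) ∈ S}ᶜ ∩ {_x | y₀ ∈ C}) := by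
    ext x
    simp only [Set.mem_preimage, Set.mem_union, Set.mem_inter_iff, Set.mem_ofPred_eq,
      Set.mem_image, Prod.exists, exists_and_right, exists_eq_right, Set.mem_compl_iff]
    by_cases hx : ∃! y, (x, y) ∈ S
    · simp only [hx, true_and, not_true_eq_false, false_and, or_false]
      constructor
      · exact fun h => ⟨g x, hg x hx, h⟩
      · rintro ⟨y, hy, hyC⟩
        rwa [hx.unique (hg x hx) hy]
    · simp [hx, hg' x hx]
  rw [h]
  exact (hU.inter (measurableSet_image_fst (hS.inter (hC.preimage continuous_snd)))).union
    (hU.compl.inter (MeasurableSet.const _))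

theorem measurable_potential {m n : ℕ} (r : Fin m → ℝ) (c : Fin n → ℝ) :
    Measurable fun x : EuclideanSpace ℝ (Fin n × Fin m) =>
      potential GaugeOrthogonal r c (unvec x) := by
  refine measurable_of_existsUnique_mem (S := {u | IsScalingPotential r c (unvec u.1) u.2 ∧
    GaugeOrthogonal u.2}) ?_ (y₀ := 0) (fun x hx => potential_spec hx) fun x hx => dif_neg hx
  have h1 : IsClosed {u : EuclideanSpace ℝ (Fin n × Fin m) × Pot m n |
      ∀ i, ∑ j, scaled (unvec u.1) u.2 i j = r i} := by
    simp only [scaled_apply', unvec_apply, Set.ofPred_forall]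
    exact isClosed_iInter fun i => isClosed_eq (by fun_prop) (by fun_prop)
  have h2 : IsClosed {u : EuclideanSpace ℝ (Fin n × Fin m) × Pot m n |
      ∀ j, ∑ i, scaled (unvec u.1) u.2 i j = c j} := by
    simp only [scaled_apply', unvec_apply, Set.ofPred_forall]
    exact isClosed_iInter fun i => isClosed_eq (by fun_prop) (by fun_prop)
  have h3 : IsClosed {u : EuclideanSpace ℝ (Fin n × Fin m) × Pot m n | GaugeOrthogonal u.2} :=
    isClosed_eq (by fun_prop) (by fun_prop)
  exact (h1.inter h2).inter h3

end Measurability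

/-! ### The multivariate central limit theorem and the delta method -/

section Limit

variable {ι κ : Type*} [Fintype ι] [Fintype κ] [DecidableEq κ]

theorem sum_sum_cov_eq_variance {Ω₀ : Type*} [MeasurableSpace Ω₀] {P₀ : Measure Ω₀}
    [IsProbabilityMeasure P₀] {V : Ω₀ → EuclideanSpace ℝ ι}
    (hV : ∀ i, MemLp (fun ω => V ω i) 2 P₀) (t : ι → ℝ) :
    t ⬝ᵥ (Matrix.of fun i j => cov[fun ω => V ω i, fun ω => V ω j; P₀]).mulVec t =
      Var[fun ω => ∑ i, t i * V ω i; P₀] := by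
  rw [variance_fun_sum fun i => (hV i).const_mul (t i)]
  simp only [dotProduct, Matrix.mulVec, Matrix.of_apply, Finset.mul_sum,
    covariance_const_mul_left, covariance_const_mul_right]
  exact Finset.sum_congr rfl fun i _ => Finset.sum_congr rfl fun j _ => by ring

theorem posSemidef_cov {Ω₀ : Type*} [MeasurableSpace Ω₀] {P₀ : Measure Ω₀}
    [IsProbabilityMeasure P₀] {V : Ω₀ → EuclideanSpace ℝ ι}
    (hV : ∀ i, MemLp (fun ω => V ω i) 2 P₀) :
    (Matrix.of fun i j => cov[fun ω => V ω i, fun ω => V ω j; P₀]).PosSemidef := by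
  refine Matrix.PosSemidef.of_dotProduct_mulVec_nonneg ?_ fun t => ?_
  · ext i j
    simp [covariance_comm]
  · rw [star_trivial, sum_sum_cov_eq_variance hV]
    exact variance_nonneg _ _

/-- The Cramér–Wold device: it reduces the multivariate limit to one-dimensional ones. -/
theorem charFun_map_eq_charFun_map_inner {Ω E : Type*} [MeasurableSpace Ω] {P : Measure Ω}
    [NormedAddCommGroup E] [InnerProductSpace ℝ E] [MeasurableSpace E] [BorelSpace E]
    [SecondCountableTopology E] {Z : Ω → E} (hZ : AEMeasurable Z P) (t : E) :
    charFun (P.map Z) t = charFun (P.map fun ω => inner ℝ (Z ω) t) 1 := by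
  have h : AEMeasurable (fun ω => inner ℝ (Z ω) t) P := hZ.inner_const
  rw [charFun_apply, charFun_apply, integral_map hZ (by fun_prop), integral_map h (by fun_prop)]
  simp

variable [DecidableEq ι]

/-- The multivariate central limit theorem. -/
theorem tendstoInDistribution_multivariate {Ω₀ : Type*} [MeasurableSpace Ω₀] {P₀ : Measure Ω₀}
    [IsProbabilityMeasure P₀] {V : Ω₀ → EuclideanSpace ℝ ι}
    (hV : ∀ i, MemLp (fun ω => V ω i) 2 P₀) {x₀ : EuclideanSpace ℝ ι}
    (hmean : ∀ i, ∫ ω, V ω i ∂P₀ = x₀ i)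
    {Ω : Type*} [MeasurableSpace Ω] {P : Measure Ω} [IsProbabilityMeasure P]
    {U : ℕ → Ω → EuclideanSpace ℝ ι} (hindep : iIndepFun U P)
    (hident : ∀ l, IdentDistrib (U l) V P P₀) :
    TendstoInDistribution
      (fun (M : ℕ) ω => √(M : ℝ) • ((M : ℝ)⁻¹ • ∑ l ∈ Finset.range M, U l ω - x₀)) atTop id
      (fun _ => P)
      (multivariateGaussian 0 (Matrix.of fun i j => cov[fun ω => V ω i, fun ω => V ω j; P₀])) where
  forall_aemeasurable M := by
    have := fun l => (hident l).aemeasurable_fst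
    fun_prop
  tendsto := by
    refine ProbabilityMeasure.tendsto_iff_tendsto_charFun.2 fun t => ?_
    have hmeas := fun l => (hident l).aemeasurable_fst
    have hin : ∀ x : EuclideanSpace ℝ ι, inner ℝ x t = ∑ i, t i * x i := fun x => by
      simp [PiLp.inner_apply]
    have hf : Measurable fun x : EuclideanSpace ℝ ι => inner ℝ x t := by fun_prop
    have hid : ∀ l, IdentDistrib (fun ω => inner ℝ (U l ω) t) (fun ω => inner ℝ (V ω) t) P P₀ :=
      fun l => (hident l).comp hf
    have hVt : MemLp (fun ω => inner ℝ (V ω) t) 2 P₀ := by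
      simp only [hin]
      exact memLp_finsetSum _ fun i _ => (hV i).const_mul (t i)
    have hmean' : ∫ ω, inner ℝ (V ω) t ∂P₀ = inner ℝ x₀ t := by
      simp only [hin]
      rw [integral_finsetSum _ fun i _ => ((hV i).const_mul (t i)).integrable one_le_two]
      simp only [integral_const_mul, hmean]
    have hreal := tendstoInDistribution_inv_sqrt_mul_sum_sub (P := P)
      (P' := gaussianReal 0 (Var[fun ω => inner ℝ (U 0 ω) t; P]).toNNReal) (Y := id)
      (X := fun l ω => inner ℝ (U l ω) t) ⟨aemeasurable_id, Measure.map_id⟩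
      ((hid 0).memLp_iff.2 hVt) (hindep.comp (fun _ x => inner ℝ x t) fun _ => hf)
      (fun l => (hid l).trans (hid 0).symm)
    have hlim := ProbabilityMeasure.tendsto_iff_tendsto_charFun.1 hreal.tendsto 1
    simp only [ProbabilityMeasure.coe_mk, Measure.map_id] at hlim ⊢
    have hvar : t.ofLp ⬝ᵥ (Matrix.of fun i j =>
        cov[fun ω => V ω i, fun ω => V ω j; P₀]).mulVec t.ofLp =
        Var[fun ω => inner ℝ (V ω) t; P₀] := by
      rw [sum_sum_cov_eq_variance hV]
      simp only [hin]
    rw [charFun_multivariateGaussian (posSemidef_cov hV), hvar]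
    rw [charFun_gaussianReal, (hid 0).variance_eq] at hlim
    simp only [Real.coe_toNNReal _ (variance_nonneg _ _)] at hlim
    convert! hlim using 2 with M
    · rw [charFun_map_eq_charFun_map_inner (by fun_prop)]
      congr 2
      funext ω
      rw [(hid 0).integral_eq, hmean', inner_smul_left, inner_sub_left, inner_smul_left,
        sum_inner]
      simp only [RCLike.conj_to_real]
      -- With `S` the sum and `μ` the mean, this is `√M (S / M - μ) = (S - M μ) / √M`; at `M = 0`
      -- both sides are zero.
      rcases Nat.eq_zero_or_pos M with rfl | hM
      · simp
      · have hM' : (0 : ℝ) < M := by exact_mod_cast hM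
        have hs0 := (Real.sqrt_pos.2 hM').ne'
        field_simp
        rw [Real.sq_sqrt hM'.le]
    · simp

/-- Convergence in distribution depends only on the law of the limit, so the limit can be taken to
be the identity on that law. -/
theorem _root_.MeasureTheory.TendstoInDistribution.id_of_map_eq {α Ω Ω' E : Type*}
    [MeasurableSpace Ω] [MeasurableSpace Ω'] [TopologicalSpace E] [MeasurableSpace E]
    [OpensMeasurableSpace E] {P : Measure Ω} [IsProbabilityMeasure P] {P' : Measure Ω'}
    [IsProbabilityMeasure P'] {ν : Measure E} [IsProbabilityMeasure ν] {l : Filter α}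
    {X : α → Ω → E} {Z : Ω' → E} (h : TendstoInDistribution X l Z (fun _ => P) P')
    (hν : P'.map Z = ν) : TendstoInDistribution X l id (fun _ => P) ν where
  forall_aemeasurable := h.forall_aemeasurable
  tendsto := by
    have h1 := h.tendsto
    have : (⟨P'.map Z, Measure.isProbabilityMeasure_map h.aemeasurable_limit⟩ :
        ProbabilityMeasure E) = ⟨ν.map id, Measure.isProbabilityMeasure_map aemeasurable_id⟩ := by
      apply Subtype.ext
      simp [hν]
    rwa [this] at h1

/-- The delta method: if `√M (x_M - x₀)` converges in distribution, then so does
`√M (g x_M - g x₀)`, to the image of the limit under the derivative of `g` at `x₀`. -/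
theorem tendstoInDistribution_delta {Ω Ω' E F : Type*} [MeasurableSpace Ω] [MeasurableSpace Ω']
    [NormedAddCommGroup E] [NormedSpace ℝ E] [MeasurableSpace E] [BorelSpace E]
    [SecondCountableTopology E]
    [NormedAddCommGroup F] [NormedSpace ℝ F] [MeasurableSpace F] [BorelSpace F]
    [SecondCountableTopology F]
    {P : Measure Ω} [IsProbabilityMeasure P] {P' : Measure Ω'} [IsProbabilityMeasure P']
    {g : E → F} (hg : Measurable g) {D : E →L[ℝ] F} {x₀ : E} (hD : HasFDerivAt g D x₀)
    {x : ℕ → Ω → E} {Z : Ω' → E} (hx : ∀ M, AEMeasurable (x M) P)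
    (hx₀ : ∀ᵐ ω ∂P, Tendsto (fun M => x M ω) atTop (𝓝 x₀))
    (hZ : TendstoInDistribution (fun (M : ℕ) ω => √(M : ℝ) • (x M ω - x₀)) atTop Z (fun _ => P)
      P') :
    TendstoInDistribution (fun (M : ℕ) ω => √(M : ℝ) • (g (x M ω) - g x₀)) atTop
      (fun ω => D (Z ω)) (fun _ => P) P' := by
  -- The normalized remainder of the first-order expansion, zero at `x₀` by the convention for
  -- inverses. Differentiability says that it tends to `0` at `x₀`.
  set h : E → F := fun y => ‖y - x₀‖⁻¹ • (g y - g x₀ - D (y - x₀)) with hh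
  have hmeas : Measurable h := by
    have : Measurable fun y => D (y - x₀) := by fun_prop
    exact (by fun_prop : Measurable fun y : E => ‖y - x₀‖⁻¹).smul
      ((hg.sub measurable_const).sub this)
  have hlim : Tendsto h (𝓝 x₀) (𝓝 0) := by
    rw [tendsto_zero_iff_norm_tendsto_zero]
    have := hasFDerivAt_iff_tendsto.1 hD
    simpa [hh, norm_smul] using this
  have hm : TendstoInMeasure P (fun M ω => h (x M ω)) atTop (fun _ => (0 : F)) := by
    refine tendstoInMeasure_of_tendsto_ae
      (fun M => (hmeas.comp_aemeasurable (hx M)).aestronglyMeasurable) ?_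
    filter_upwards [hx₀] with ω hω using hlim.comp hω
  -- Slutsky: with `Z_M = √M (x_M - x₀)`, the rescaled error is exactly `D Z_M + ‖Z_M‖ h(x_M)`, a
  -- continuous function of a pair whose second component tends to `0` in probability.
  have key := hZ.continuous_comp_prodMk_of_tendstoInMeasure_const
    (g := fun u : E × F => D u.1 + ‖u.1‖ • u.2) (by fun_prop) hm
    (fun M => hmeas.comp_aemeasurable (hx M))
  refine key.congr (fun M => Eventually.of_forall fun ω => ?_)
    (Eventually.of_forall fun ω => by simp)
  simp only [hh, map_smul, norm_smul, Real.norm_eq_abs, abs_of_nonneg (Real.sqrt_nonneg _)]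
  rcases eq_or_ne (x M ω) x₀ with hx | hx
  · simp [hx]
  · rw [smul_smul, mul_assoc, mul_inv_cancel₀ (norm_ne_zero_iff.2 (sub_ne_zero.2 hx)), mul_one,
      ← smul_add]
    congr 1
    abel

/-- A linear image of a centered Gaussian vector. -/
theorem map_multivariateGaussian {S : Matrix ι ι ℝ} (hS : S.PosSemidef) (B : Matrix κ ι ℝ) :
    (multivariateGaussian 0 S).map
      (LinearMap.toContinuousLinearMap (Matrix.toLpLin 2 2 B)) =
      multivariateGaussian 0 (B * S * B.transpose) := by
  have hS' : (B * S * B.transpose).PosSemidef := by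
    rw [← Matrix.conjTranspose_eq_transpose_of_trivial]
    exact hS.mul_mul_conjTranspose_same B
  refine Measure.ext_of_charFun ?_
  funext t
  have hadj : ∀ x : EuclideanSpace ℝ ι,
      inner ℝ (LinearMap.toContinuousLinearMap (Matrix.toLpLin 2 2 B) x) t =
        inner ℝ x (WithLp.toLp 2 (B.transpose.mulVec t.ofLp)) := fun x => by
    simp only [EuclideanSpace.inner_eq_star_dotProduct, LinearMap.coe_toContinuousLinearMap',
      Matrix.ofLp_toLpLin, Matrix.toLin'_apply, star_trivial]
    rw [Matrix.dotProduct_mulVec, ← Matrix.mulVec_transpose]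
  have h : charFun ((multivariateGaussian 0 S).map
      (LinearMap.toContinuousLinearMap (Matrix.toLpLin 2 2 B))) t =
      charFun (multivariateGaussian 0 S) (WithLp.toLp 2 (B.transpose.mulVec t.ofLp)) := by
    rw [charFun_apply, charFun_apply, integral_map (by fun_prop) (by fun_prop)]
    simp only [hadj]
  rw [h, charFun_multivariateGaussian hS', charFun_multivariateGaussian hS]
  congr 4
  · simp
  · rw [← Matrix.mulVec_mulVec, ← Matrix.mulVec_mulVec, Matrix.dotProduct_mulVec _ B,
      ← Matrix.mulVec_transpose]

end Limit

/-! ### The empirical mean and its potentials -/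

section EmpiricalMean

variable {m n : ℕ} {Λ : Matrix (Fin m) (Fin n) ℝ} {σ R : ℝ}
  {Ω₀ : Type*} [MeasurableSpace Ω₀] {P₀ : Measure Ω₀}
  {X : Ω₀ → Matrix (Fin m) (Fin n) ℝ}

/-- The case `q = 2` of the moment condition. -/
theorem IsSubexponential.memLp_two [IsFiniteMeasure P₀] (hX : IsSubexponential P₀ X Λ σ R)
    (i : Fin m) (j : Fin n) : MemLp (fun ω => X ω i j) 2 P₀ := by
  have h : MemLp (fun ω => X ω i j - Λ i j) 2 P₀ := by
    refine ⟨((hX.aemeasurable i j).sub_const _).aestronglyMeasurable, ?_⟩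
    rw [eLpNorm_lt_top_iff_lintegral_rpow_enorm_lt_top two_ne_zero ENNReal.ofNat_ne_top]
    refine lt_of_eq_of_lt ?_ ((hX.moment_le 2 le_rfl i j).trans_lt ENNReal.ofReal_lt_top)
    refine lintegral_congr fun ω => ?_
    rw [ENNReal.ofReal_pow (abs_nonneg _), ← Real.enorm_eq_ofReal_abs]
    simp
  have := h.add (memLp_const (Λ i j))
  simpa [Pi.add_def] using this

theorem measurable_toLp_vec : Measurable (fun v : Fin n × Fin m → ℝ => WithLp.toLp 2 v) := by
  fun_prop

theorem toLp_vec_empMean {Ω : Type*} (Y : ℕ → Ω → Matrix (Fin m) (Fin n) ℝ) (M : ℕ) (ω : Ω) :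
    (WithLp.toLp 2 (empMean Y M ω).vec : EuclideanSpace ℝ (Fin n × Fin m)) =
      (M : ℝ)⁻¹ • ∑ l ∈ Finset.range M, WithLp.toLp 2 (Y l ω).vec := by
  ext p
  simp [empMean, Matrix.vec, Matrix.sum_apply]

variable {Ω : Type*} [MeasurableSpace Ω] {P : Measure Ω}
  {Y : ℕ → Ω → Matrix (Fin m) (Fin n) ℝ}

theorem aemeasurable_empMean
    (hident : ∀ l, IdentDistrib (fun ω => (Y l ω).vec) (fun ω => (X ω).vec) P P₀) (M : ℕ) :
    AEMeasurable (fun ω => (WithLp.toLp 2 (empMean Y M ω).vec :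
      EuclideanSpace ℝ (Fin n × Fin m))) P := by
  have := fun l => measurable_toLp_vec.comp_aemeasurable (hident l).aemeasurable_fst
  simp only [toLp_vec_empMean]
  exact AEMeasurable.const_smul (M := ℝ) (Finset.aemeasurable_fun_sum _ fun l _ => this l) _

theorem covVec_eq : covVec P₀ X = Matrix.of fun p q =>
    cov[fun ω => (WithLp.toLp 2 (X ω).vec : EuclideanSpace ℝ (Fin n × Fin m)) p,
      fun ω => (WithLp.toLp 2 (X ω).vec : EuclideanSpace ℝ (Fin n × Fin m)) q; P₀] := rfl

/-- The strong law of large numbers applied to each entry; there are finitely many. -/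
theorem IsSubexponential.ae_tendsto_empMean (hX : IsSubexponential P₀ X Λ σ R)
    (hindep : iIndepFun (fun l ω => (Y l ω).vec) P)
    (hident : ∀ l, IdentDistrib (fun ω => (Y l ω).vec) (fun ω => (X ω).vec) P P₀) :
    ∀ᵐ ω ∂P, Tendsto (fun M => (WithLp.toLp 2 (empMean Y M ω).vec :
      EuclideanSpace ℝ (Fin n × Fin m))) atTop (𝓝 (WithLp.toLp 2 Λ.vec)) := by
  have hcoord : ∀ p : Fin n × Fin m, ∀ᵐ ω ∂P,
      Tendsto (fun M => empMean Y M ω p.2 p.1) atTop (𝓝 (Λ p.2 p.1)) := by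
    intro p
    have hid : ∀ l, IdentDistrib (fun ω => Y l ω p.2 p.1) (fun ω => X ω p.2 p.1) P P₀ := fun l =>
      (hident l).comp (measurable_pi_apply p)
    have h := strong_law_ae_real (fun l ω => Y l ω p.2 p.1)
      ((hid 0).integrable_iff.2 (hX.integrable p.2 p.1))
      (fun k l hkl => (hindep.indepFun hkl).comp (measurable_pi_apply p) (measurable_pi_apply p))
      (fun l => (hid l).trans (hid 0).symm)
    rw [(hid 0).integral_eq, hX.mean_eq] at h
    filter_upwards [h] with ω hω
    refine hω.congr fun M => ?_
    simp [empMean, Matrix.sum_apply, div_eq_inv_mul]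
  filter_upwards [ae_all_iff.2 hcoord] with ω hω
  exact ((PiLp.continuous_toLp 2 fun _ : Fin n × Fin m => ℝ).tendsto _).comp
    (tendsto_pi_nhds.2 hω)

variable [IsProbabilityMeasure P]

theorem tendsto_measure_of_ae_eventually {s : ℕ → Set Ω} (h : ∀ᵐ ω ∂P, ∀ᶠ M in atTop, ω ∈ s M) :
    Tendsto (fun M => P (s M)) atTop (𝓝 1) := by
  -- The tail sets increase to a set of full measure, so continuity from below applies; the sets `s
  -- M` need not be measurable.
  set t : ℕ → Set Ω := fun M => {ω | ∀ k, M ≤ k → ω ∈ s k} with ht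
  have hmono : Monotone t := fun a b hab ω hω k hk => hω k (hab.trans hk)
  have hU : P (⋃ M, t M) = 1 := by
    have : (⋃ M, t M) =ᵐ[P] Set.univ := by
      rw [ae_eq_univ, ← mem_ae_iff]
      filter_upwards [h] with ω hω
      obtain ⟨M, hM⟩ := eventually_atTop.1 hω
      exact Set.mem_iUnion.2 ⟨M, hM⟩
    rw [measure_congr this, measure_univ]
  refine tendsto_of_tendsto_of_tendsto_of_le_of_le (hU ▸ tendsto_measure_iUnion_atTop hmono)
    tendsto_const_nhds (fun M => measure_mono fun ω (hω : ω ∈ t M) => hω M le_rfl)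
    fun M => prob_le_one

theorem IsSubexponential.tendsto_measure_existsUnique {r : Fin m → ℝ} {c : Fin n → ℝ}
    (hrc : IsPositiveMargin r c) (hX : IsSubexponential P₀ X Λ σ R)
    (hindep : iIndepFun (fun l ω => (Y l ω).vec) P)
    (hident : ∀ l, IdentDistrib (fun ω => (Y l ω).vec) (fun ω => (X ω).vec) P P₀) :
    Tendsto (fun M : ℕ => P {ω | ∃! ξ, IsScalingPotential r c (empMean Y M ω) ξ ∧
      GaugeOrthogonal ξ}) atTop (𝓝 1) := by
  refine tendsto_measure_of_ae_eventually ?_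
  filter_upwards [hX.ae_tendsto_empMean hindep hident] with ω hω
  have hpos : ∀ᶠ M in atTop, ∀ i j, 0 < empMean Y M ω i j := by
    refine eventually_all.2 fun i => eventually_all.2 fun j => ?_
    have hc : Continuous fun x : EuclideanSpace ℝ (Fin n × Fin m) => x (j, i) := by fun_prop
    exact ((hc.tendsto _).comp hω).eventually (lt_mem_nhds (hX.mean_pos i j))
  filter_upwards [hpos] with M hM using existsUnique_gaugeOrthogonal hrc hM

variable [IsProbabilityMeasure P₀]

theorem IsSubexponential.posSemidef_covVec (hX : IsSubexponential P₀ X Λ σ R) :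
    (covVec P₀ X).PosSemidef :=
  posSemidef_cov (V := fun ω => WithLp.toLp 2 (X ω).vec) fun p => hX.memLp_two p.2 p.1

/-- The central limit theorem for the gauge-orthogonal potentials. -/
theorem IsSubexponential.tendstoInDistribution_gaugeOrthogonal {r : Fin m → ℝ} {c : Fin n → ℝ}
    (hrc : IsPositiveMargin r c) (hX : IsSubexponential P₀ X Λ σ R)
    (hindep : iIndepFun (fun l ω => (Y l ω).vec) P)
    (hident : ∀ l, IdentDistrib (fun ω => (Y l ω).vec) (fun ω => (X ω).vec) P P₀)
    {ξ : Pot m n} (hξ : IsScalingPotential r c Λ ξ) :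
    TendstoInDistribution
      (fun (M : ℕ) ω => √(M : ℝ) •
        (potential GaugeOrthogonal r c (empMean Y M ω) - potential GaugeOrthogonal r c Λ))
      atTop id (fun _ => P)
      (multivariateGaussian 0
        (pinv (blockL r c (scaled Λ ξ)) * opH ξ * covVec P₀ X * (opH ξ).transpose *
          (pinv (blockL r c (scaled Λ ξ))).transpose)) := by
  have hclt := tendstoInDistribution_multivariate (P := P)
    (V := fun ω => WithLp.toLp 2 (X ω).vec) (x₀ := WithLp.toLp 2 Λ.vec)
    (U := fun l ω => WithLp.toLp 2 (Y l ω).vec)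
    (fun p => hX.memLp_two p.2 p.1) (fun p => hX.mean_eq p.2 p.1)
    (hindep.comp (fun _ v => WithLp.toLp 2 v) fun _ => measurable_toLp_vec)
    (fun l => (hident l).comp measurable_toLp_vec)
  simp only [← toLp_vec_empMean, ← covVec_eq] at hclt
  have hdelta := tendstoInDistribution_delta (measurable_potential r c)
    (hasFDerivAt_potential hrc hX.mean_pos hξ) (aemeasurable_empMean hident)
    (hX.ae_tendsto_empMean hindep hident) hclt
  refine hdelta.id_of_map_eq ?_
  -- The derivative is `-L† H`; its sign enters the covariance twice and cancels.
  have hmap := map_multivariateGaussian hX.posSemidef_covVec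
    (-(pinv (blockL r c (scaled Λ ξ)) * opH ξ))
  refine hmap.trans (congrArg _ ?_)
  simp only [Matrix.transpose_neg, Matrix.transpose_mul, Matrix.neg_mul, Matrix.mul_neg, neg_neg,
    Matrix.mul_assoc]

/-- The central limit theorem for the column-centered potentials. -/
theorem IsSubexponential.tendstoInDistribution_colCentered {r : Fin m → ℝ} {c : Fin n → ℝ}
    (hrc : IsPositiveMargin r c) (hX : IsSubexponential P₀ X Λ σ R)
    (hindep : iIndepFun (fun l ω => (Y l ω).vec) P)
    (hident : ∀ l, IdentDistrib (fun ω => (Y l ω).vec) (fun ω => (X ω).vec) P P₀)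
    {ξ : Pot m n} (hξ : IsScalingPotential r c Λ ξ) :
    TendstoInDistribution
      (fun (M : ℕ) ω => √(M : ℝ) •
        (potential (ColCentered c) r c (empMean Y M ω) - potential (ColCentered c) r c Λ))
      atTop id (fun _ => P)
      (multivariateGaussian 0
        (colProj m c * (pinv (blockL r c (scaled Λ ξ)) * opH ξ * covVec P₀ X *
          (opH ξ).transpose * (pinv (blockL r c (scaled Λ ξ))).transpose) *
            (colProj m c).transpose)) := by
  set T : Pot m n →L[ℝ] Pot m n :=
    LinearMap.toContinuousLinearMap (Matrix.toLpLin 2 2 (colProj m c)) with hT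
  have hpot : ∀ A : Matrix (Fin m) (Fin n) ℝ,
      potential (ColCentered c) r c A = T (potential GaugeOrthogonal r c A) := fun A =>
    potential_colCentered hrc A
  have h := (hX.tendstoInDistribution_gaugeOrthogonal hrc hindep hident hξ).continuous_comp
    T.continuous
  have h' := h.congr (Y := fun (M : ℕ) ω => √(M : ℝ) •
      (potential (ColCentered c) r c (empMean Y M ω) - potential (ColCentered c) r c Λ)) (T := T)
    (fun M => Eventually.of_forall fun ω => by
      simp only [Function.comp_apply, hpot, map_smul, map_sub])
    (Eventually.of_forall fun _ => rfl)
  refine h'.id_of_map_eq (map_multivariateGaussian ?_ _)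
  have := hX.posSemidef_covVec.mul_mul_conjTranspose_same
    (pinv (blockL r c (scaled Λ ξ)) * opH ξ)
  rw [Matrix.conjTranspose_eq_transpose_of_trivial, Matrix.transpose_mul] at this
  simpa only [Matrix.mul_assoc] using this

end EmpiricalMean

end SinkhornCLT

theorem mainTheorem7 {m n : ℕ}
    (r : Fin m → ℝ) (c : Fin n → ℝ) (hrc : IsPositiveMargin r c)
    (δ : ℝ) (hδ : IsSmoothMargin δ r c)
    (Λ : Matrix (Fin m) (Fin n) ℝ) (K : ℝ) (hK : HasBoundedCost K r c Λ)
    {Ω₀ : Type*} [MeasurableSpace Ω₀] (P₀ : Measure Ω₀) [IsProbabilityMeasure P₀]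
    (X : Ω₀ → Matrix (Fin m) (Fin n) ℝ) (σ R : ℝ) (hX : IsSubexponential P₀ X Λ σ R)
    {Ω : Type*} [MeasurableSpace Ω] (P : Measure Ω) [IsProbabilityMeasure P]
    (Y : ℕ → Ω → Matrix (Fin m) (Fin n) ℝ)
    (hindep : iIndepFun (fun l ω => (Y l ω).vec) P)
    (hident : ∀ l, IdentDistrib (fun ω => (Y l ω).vec) (fun ω => (X ω).vec) P P₀) :
    -- existence and uniqueness of the potentials of `Λ`, in either normalization
    (∃! ξ, IsScalingPotential r c Λ ξ ∧ ColCentered c ξ) ∧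
    (∃! ξ, IsScalingPotential r c Λ ξ ∧ GaugeOrthogonal ξ) ∧
    -- the same for the empirical mean, with probability tending to one
    Tendsto (fun M : ℕ => P {ω | ∃! ξ, IsScalingPotential r c (empMean Y M ω) ξ ∧
      ColCentered c ξ}) atTop (𝓝 1) ∧
    Tendsto (fun M : ℕ => P {ω | ∃! ξ, IsScalingPotential r c (empMean Y M ω) ξ ∧
      GaugeOrthogonal ξ}) atTop (𝓝 1) ∧
    -- `L` and `H` are the same for all scaling potentials `ξ` of `Λ`
    ∀ (ξ : Pot m n), IsScalingPotential r c Λ ξ →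
    ∀ (L : Matrix (Fin m ⊕ Fin n) (Fin m ⊕ Fin n) ℝ), L = blockL r c (scaled Λ ξ) →
    ∀ (H : Matrix (Fin m ⊕ Fin n) (Fin n × Fin m) ℝ), H = opH ξ →
      -- potentials with `∑ α = ∑ β`
      TendstoInDistribution
        (fun (M : ℕ) ω => √(M : ℝ) •
          (potential GaugeOrthogonal r c (empMean Y M ω) - potential GaugeOrthogonal r c Λ))
        atTop id (fun _ => P)
        (multivariateGaussian 0
          (pinv L * H * covVec P₀ X * H.transpose * (pinv L).transpose)) ∧
      -- potentials with `⟨β, c⟩ = 0`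
      TendstoInDistribution
        (fun (M : ℕ) ω => √(M : ℝ) •
          (potential (ColCentered c) r c (empMean Y M ω) - potential (ColCentered c) r c Λ))
        atTop id (fun _ => P)
        (multivariateGaussian 0
          (colProj m c * (pinv L * H * covVec P₀ X * H.transpose * (pinv L).transpose) *
            (colProj m c).transpose)) := by
  have hG := existsUnique_gaugeOrthogonal hrc hX.mean_pos
  have hP := hX.tendsto_measure_existsUnique hrc hindep hident
  refine ⟨(existsUnique_colCentered_iff hrc Λ).2 hG, hG, ?_, hP, ?_⟩
  -- The two events coincide, since the equivalence holds for every matrix.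
  · simpa only [existsUnique_colCentered_iff hrc] using hP
  · rintro ξ hξ _ rfl _ rfl
    exact ⟨hX.tendstoInDistribution_gaugeOrthogonal hrc hindep hident hξ,
      hX.tendstoInDistribution_colCentered hrc hindep hident hξ⟩
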